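/- **Setting.** Let $p\ge 0$ be fixed. Consider a sequence of stages $k\to\infty$; at stage $k$ there are $m=m_k$ clusters of sizes $n_i=n_{k,i}$ ($1\le i\le m$), with non-random covariates $x_{ij}\in\mathbb R^p$ ($1\le j\le n_i$), random effects $\dot b_i\in\mathbb R^p$ and real responses $y_{ij}$ (all of these may depend on $k$). Put $n_L=\min_{i\le m} n_i$, $n=m^{-1}\sum_{i\le m} n_i$, and let $X_i$ be the $n_i\times p$ matrix with rows $x_{ij}^\top$. The random effects $\dot b_1,\dots,\dot b_m$ are i.i.d. $N(0,\dot G)$ with $\dot G$ positive semidefinite. Conditionally on them the $y_{ij}$ are independent, $y_{ij}$ having density $$f(y\mid\eta,\dot\phi)=\exp\big[\dot\phi^{-1}\{y\eta-a(\eta)\}+c(y,\dot\phi)\big]\quad\text{at }\eta=\dot\eta_{ij}=x_{ij}^\top\dot\beta+x_{ij}^\top\dot b_i$$ with respect to a $\sigma$-finite measure on $\mathbb R$ (exponential family, canonical link, every covariate carrying both a fixed and a random effect), where $\dot\phi>0$ and $f(\cdot\mid\eta,\dot\phi)$ is a probability density for every $\eta\in\mathbb R$. Given a working dispersion $\hat\phi=\hat\phi_k$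 and a working covariance matrix $\hat G=\hat G_k$ (possibly random and data-dependent), the PQL estimator $(\hat\beta,\hat b_1,\dots,\hat b_m)$ is a maximizer over all $(\beta,b_1,\dots,b_m)\in\mathbb R^{(m+1)p}$ of $$Q(\beta,b)=\sum_{i=1}^m\sum_{j=1}^{n_i}\ln f(y_{ij}\mid x_{ij}^\top\beta+x_{ij}^\top b_i,\hat\phi)-\tfrac12\sum_{i=1}^m b_i^\top\hat G^{-1}b_i .$$ **Assumptions.** $m\to\infty$, $n_L\to\infty$, $n_i=O(n_L)$ uniformly in $i\le m$, $m/n_L^2\to0$, and: * (C1) $a:\mathbb R\to\mathbb R$ is three times continuously differentiable and for some $c_0>0$, $c_0\le a''(\eta)\le c_0^{-1}$ and $|a'''(\eta)|\le c_0^{-1}$ for all $\eta$. * (C2) $\|x_{ij}\|_\infty<C_1$ for a constant $C_1$. For all large $k$ the matrices $\dot H_i=\big(n_i^{-1}\dot\phi^{-1}X_i^\top\mathrm{diag}\{a''(\dot\eta_{i1}),\dots,a''(\dot\eta_{in_i})\}X_i\big)^{-1}$, $i\le m$, exist almost surely. For every $i$, $\dot H_i$ converges in probability to a matrix $\dot K_i$,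 and $m^{-1}\sum_{i\le m}(n/n_i)\dot H_i$ converges in probability to a matrix $\dot K$; the limits (possibly random) are almost surely positive definite with all eigenvalues in $[c_1,c_1^{-1}]$ for a common constant $c_1>0$. * (C4) $\hat G$ is almost surely symmetric positive definite with $\hat G^{-1}=O_p(1)$, and $\hat\phi$ is almost surely strictly positive with $\hat\phi=O_p(1)$. * (C5) For all $k$ and $i\le m$, with $\dot W_i=\hat\phi^{-1}\mathrm{diag}\{a''(\dot\eta_{i1}),\dots,a''(\dot\eta_{in_i})\}$ and $\dot\mu_{ij}=a'(\dot\eta_{ij})$, each component of $n_i^{1/2}(X_i^\top\dot W_iX_i+\hat G^{-1})^{-1}\{\hat\phi^{-1}X_i^\top(y_i-\dot\mu_i)-\hat G^{-1}\dot b_i\}$ has a finite fourth moment. **Conclusion.** Unconditionally on the random effects, $$m^{1/2}(\hat\beta-\dot\beta)\ \xrightarrow{D}\ N(0,\dot G),$$ and the limit is driven by the average of the true random effects: $m^{1/2}(\hat\beta-\dot\beta)-m^{-1/2}\sum_{i=1}^m\dot b_i\to0$ in probability. -/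

import Mathlib

open MeasureTheory ProbabilityTheory Filter Topology
open scoped Matrix ENNReal

noncomputable section

namespace PQL

/-- Coefficient and covariate vectors. -/
abbrev Vec (p : ℕ) : Type := EuclideanSpace ℝ (Fin p)

/-! ### Cluster sizes -/

/-- The smallest cluster size `n_L = min_{i < m} n i` (for `m = 0` this is `0`). -/
def minSize (m : ℕ) (n : ℕ → ℕ) : ℕ := ⨅ i : Fin m, n i

/-- The mean cluster size `m⁻¹ ∑_{i < m} n i`. -/
def meanSize (m : ℕ) (n : ℕ → ℕ) : ℝ := (m : ℝ)⁻¹ * ∑ i : Fin m, (n i : ℝ)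

/-! ### The exponential family and the mixed model -/

/-- Log-density of the exponential family with natural parameter `η` and dispersion `φ`. -/
def logDensity (a : ℝ → ℝ) (c : ℝ → ℝ → ℝ) (φ η y : ℝ) : ℝ := φ⁻¹ * (y * η - a η) + c y φ

/-- Density of the exponential family. -/
def density (a : ℝ → ℝ) (c : ℝ → ℝ → ℝ) (φ η y : ℝ) : ℝ := Real.exp (logDensity a c φ η y)

/-- For the dispersion `φ`, the functions `logDensity a c φ η`, `η ∈ ℝ`, are log-densities of
probability measures with respect to `ν`. -/
def IsExpFamily (ν : Measure ℝ) (a : ℝ → ℝ) (c : ℝ → ℝ → ℝ) (φ : ℝ) : Prop :=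
  Measurable (fun y => c y φ) ∧ ∀ η : ℝ, ∫⁻ y, ENNReal.ofReal (density a c φ η y) ∂ν = 1

/-- Linear predictor `xᵀ β + xᵀ b`: the covariates are partnered, that is, the random-effects
covariates coincide with the fixed-effects covariates. -/
def linPred {p : ℕ} (x β b : Vec p) : ℝ := inner ℝ x β + inner ℝ x b

/-- The joint law of the random effects `b i` (`i < m`) and the responses `y i j`
(`i < m`, `j < n i`): the `b i` are i.i.d. `N(0, G)` and, given the random effects, the `y i j` are
independent, `y i j` having density `density a c φ (linPred (x i j) β (b i))` with respect to `ν`. -/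
def HasGLMMLaw {p : ℕ} {Ω : Type*} [MeasurableSpace Ω] (μ : Measure Ω) (ν : Measure ℝ)
    (a : ℝ → ℝ) (c : ℝ → ℝ → ℝ) (φ : ℝ) (β : Vec p) (G : Matrix (Fin p) (Fin p) ℝ)
    (m : ℕ) (n : ℕ → ℕ) (x : ℕ → ℕ → Vec p) (b : ℕ → Ω → Vec p) (y : ℕ → ℕ → Ω → ℝ) : Prop :=
  (∀ i < m, AEMeasurable (b i) μ) ∧ (∀ i < m, ∀ j < n i, AEMeasurable (y i j) μ) ∧
  μ.map (fun ω => ((fun i : Fin m => b i ω),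
      (fun q : (Σ i : Fin m, Fin (n i)) => y q.1 q.2 ω))) =
    ((Measure.pi fun _ : Fin m => multivariateGaussian (0 : Vec p) G).prod
      (Measure.pi fun _ : (Σ i : Fin m, Fin (n i)) => ν)).withDensity
      (fun w => ∏ q : (Σ i : Fin m, Fin (n i)),
        ENNReal.ofReal (density a c φ (linPred (x q.1 q.2) β (w.1 q.1)) (w.2 q)))

/-! ### Penalized quasi-likelihood -/

/-- The PQL objective function `Q(β, b)` with dispersion `φ` and random-effects covariance `G`. -/
def objective {p : ℕ} (a : ℝ → ℝ) (c : ℝ → ℝ → ℝ) (φ : ℝ) (G : Matrix (Fin p) (Fin p) ℝ)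
    (m : ℕ) (n : ℕ → ℕ) (x : ℕ → ℕ → Vec p) (y : ℕ → ℕ → ℝ) (β : Vec p) (b : Fin m → Vec p) : ℝ :=
  (∑ i : Fin m, ∑ j : Fin (n i), logDensity a c φ (linPred (x i j) β (b i)) (y i j))
    - 1 / 2 * ∑ i : Fin m, (b i).ofLp ⬝ᵥ (G⁻¹ *ᵥ (b i).ofLp)

/-- `(βhat, bhat)` maximizes the PQL objective function over all `(β, b)`. -/
def IsPQLEstimate {p : ℕ} (a : ℝ → ℝ) (c : ℝ → ℝ → ℝ) (φ : ℝ) (G : Matrix (Fin p) (Fin p) ℝ)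
    (m : ℕ) (n : ℕ → ℕ) (x : ℕ → ℕ → Vec p) (y : ℕ → ℕ → ℝ)
    (βhat : Vec p) (bhat : Fin m → Vec p) : Prop :=
  ∀ (β : Vec p) (b : Fin m → Vec p),
    objective a c φ G m n x y β b ≤ objective a c φ G m n x y βhat bhat

/-! ### Matrices attached to one cluster -/

/-- The `n × p` design matrix of a cluster, with rows `x j`. -/
def designMatrix {p : ℕ} (n : ℕ) (x : ℕ → Vec p) : Matrix (Fin n) (Fin p) ℝ :=
  Matrix.of fun j r => x j r

/-- `Xᵀ W X` with iterative weights `W = φ⁻¹ diag(a''(η_j))`, `η_j = x_jᵀ (β + b)`. -/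
def weightedGram {p : ℕ} (a : ℝ → ℝ) (φ : ℝ) (n : ℕ) (x : ℕ → Vec p) (β b : Vec p) :
    Matrix (Fin p) (Fin p) ℝ :=
  (designMatrix n x)ᵀ *
    Matrix.diagonal (fun j : Fin n => φ⁻¹ * iteratedDeriv 2 a (linPred (x j) β b)) *
    designMatrix n x

/-- `H = (n⁻¹ φ⁻¹ Xᵀ diag(a''(η_j)) X)⁻¹`, used with the true dispersion `φ`. For weights `W` with a
working dispersion `φhat > 0` this is `(n⁻¹ φhat φ⁻¹ Xᵀ W X)⁻¹`, as `φhat` cancels. -/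
def invInfo {p : ℕ} (a : ℝ → ℝ) (φ : ℝ) (n : ℕ) (x : ℕ → Vec p) (β b : Vec p) :
    Matrix (Fin p) (Fin p) ℝ :=
  ((n : ℝ)⁻¹ • weightedGram a φ n x β b)⁻¹

/-- `n^{1/2} (Xᵀ W X + G⁻¹)⁻¹ (φ⁻¹ Xᵀ (y - a'(η)) - G⁻¹ b)` for working quantities `φ`, `G`. -/
def scaledScore {p : ℕ} (a : ℝ → ℝ) (φ : ℝ) (G : Matrix (Fin p) (Fin p) ℝ) (n : ℕ)
    (x : ℕ → Vec p) (y : ℕ → ℝ) (β b : Vec p) : Fin p → ℝ :=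
  √(n : ℝ) • ((weightedGram a φ n x β b + G⁻¹)⁻¹ *ᵥ
    (φ⁻¹ • ((designMatrix n x)ᵀ *ᵥ fun j : Fin n => y j - deriv a (linPred (x j) β b))
      - G⁻¹ *ᵥ b.ofLp))

/-! ### Regularity conditions -/

/-- `Z k = O_p(1)` as `k → ∞`. -/
def BoundedInProbability {Ω : Type*} [MeasurableSpace Ω] (μ : Measure Ω) (Z : ℕ → Ω → ℝ) : Prop :=
  ∀ ε : ℝ, 0 < ε → ∃ M : ℝ, ∀ᶠ k in atTop, μ {ω | M < |Z k ω|} ≤ ENNReal.ofReal ε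

/-- `K` is positive definite with all eigenvalues in `[c₁, c₁⁻¹]`. -/
def WellConditioned {p : ℕ} (c₁ : ℝ) (K : Matrix (Fin p) (Fin p) ℝ) : Prop :=
  K.PosDef ∧ ∀ l ∈ spectrum ℝ K, c₁ ≤ l ∧ l ≤ c₁⁻¹

/-- The cumulant function is `C³` with `a''` bounded away from `0` and `∞` and `a'''` bounded. -/
def CondCumulant (a : ℝ → ℝ) : Prop :=
  ContDiff ℝ 3 a ∧ ∃ c₀ : ℝ, 0 < c₀ ∧ ∀ η : ℝ,
    c₀ ≤ iteratedDeriv 2 a η ∧ iteratedDeriv 2 a η ≤ c₀⁻¹ ∧ |iteratedDeriv 3 a η| ≤ c₀⁻¹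

/-- The covariates are uniformly bounded; for large `k` the matrices inverted in the definition of
`H_i` are invertible, so that `H_i` exists; and, entrywise in probability, `H_i` converges for each
`i`, and so does `m⁻¹ ∑_{i < m} (n / n_i) H_i` (`n` the mean cluster size), the limits being
well-conditioned with a common constant. The limits may depend on the random effects. -/
def CondDesign {p : ℕ} {Ω : Type*} [MeasurableSpace Ω] (μ : Measure Ω) (a : ℝ → ℝ) (φ : ℝ)
    (β : Vec p) (m : ℕ → ℕ) (n : ℕ → ℕ → ℕ) (x : ℕ → ℕ → ℕ → Vec p) (b : ℕ → ℕ → Ω → Vec p) :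
    Prop :=
  (∃ C₁ : ℝ, ∀ k, ∀ i < m k, ∀ j < n k i, ∀ r, |x k i j r| < C₁) ∧
  (∀ᶠ k in atTop, ∀ i < m k, ∀ᵐ ω ∂μ, IsUnit (weightedGram a φ (n k i) (x k i) β (b k i ω))) ∧
  ∃ c₁ : ℝ, 0 < c₁ ∧
    (∀ i : ℕ, ∃ K : Ω → Matrix (Fin p) (Fin p) ℝ, (∀ᵐ ω ∂μ, WellConditioned c₁ (K ω)) ∧
      ∀ r s, TendstoInMeasure μ
        (fun k ω => invInfo a φ (n k i) (x k i) β (b k i ω) r s) atTop (fun ω => K ω r s)) ∧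
    ∃ K : Ω → Matrix (Fin p) (Fin p) ℝ, (∀ᵐ ω ∂μ, WellConditioned c₁ (K ω)) ∧
      ∀ r s, TendstoInMeasure μ
        (fun k ω => (m k : ℝ)⁻¹ * ∑ i : Fin (m k), meanSize (m k) (n k) / (n k i : ℝ) *
          invInfo a φ (n k i) (x k i) β (b k i ω) r s) atTop (fun ω => K ω r s)

/-- The working covariance is a (symmetric) positive definite random matrix with `O_p(1)` inverse;
the working dispersion is a strictly positive `O_p(1)` random variable. Neither need be
consistent, and both may depend on the data. -/
def CondWorking {p : ℕ} {Ω : Type*} [MeasurableSpace Ω] (μ : Measure Ω) (φhat : ℕ → Ω → ℝ)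
    (Ghat : ℕ → Ω → Matrix (Fin p) (Fin p) ℝ) : Prop :=
  (∀ k, AEMeasurable (φhat k) μ) ∧ (∀ k r s, AEMeasurable (fun ω => Ghat k ω r s) μ) ∧
  (∀ k, ∀ᵐ ω ∂μ, (Ghat k ω).PosDef) ∧
  (∀ r s, BoundedInProbability μ (fun k ω => (Ghat k ω)⁻¹ r s)) ∧
  (∀ k, ∀ᵐ ω ∂μ, 0 < φhat k ω) ∧ BoundedInProbability μ φhat

/-- Componentwise finite fourth moments of the scaled cluster scores. -/
def CondMoment {p : ℕ} {Ω : Type*} [MeasurableSpace Ω] (μ : Measure Ω) (a : ℝ → ℝ)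
    (β : Vec p) (m : ℕ → ℕ) (n : ℕ → ℕ → ℕ) (x : ℕ → ℕ → ℕ → Vec p) (b : ℕ → ℕ → Ω → Vec p)
    (y : ℕ → ℕ → ℕ → Ω → ℝ) (φhat : ℕ → Ω → ℝ) (Ghat : ℕ → Ω → Matrix (Fin p) (Fin p) ℝ) : Prop :=
  ∀ k, ∀ i < m k, ∀ r,
    ∫⁻ ω, ENNReal.ofReal (scaledScore a (φhat k ω) (Ghat k ω) (n k i) (x k i)
      (fun j => y k i j ω) β (b k i ω) r ^ 4) ∂μ < ∞

end PQL

end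

/-! Since every covariate carries both a fixed and a random effect, moving `(β, b_i)` along `(v, -v,
…, -v)` leaves all linear predictors unchanged. Stationarity of the objective in that direction sees
only the penalty and forces `∑ bhat_i = 0`. With `Δ = βhat - β` and the total cluster error `δ_i =
(βhat + bhat_i) - (β + b_i)`, summation gives the exact identity `√m Δ - m^{-1/2} ∑ b_i = m^{-1/2} ∑
δ_i`. The law of `m^{-1/2} ∑ b_i` is exactly `N(0, G)`, so everything reduces to showing that the
right-hand side vanishes in probability.

Within a cluster, `δ_i` is close to the scoring step `t_i = (XᵀWX)⁻¹Xᵀ(y - μ)` taken at the true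
parameters. The difference is at most a constant times `τ_i (L + E_i + L‖b_i - Δ‖²)`. Here `τ_i`
measures the nondegeneracy of the design, `L` bounds the penalty `φhat Ghat⁻¹`, and `E_i` is the
squared length of `t_i` in the information metric (`norm_sub_scoringStep_le_energy`). This rests on
strong monotonicity and a Taylor bound for `a'`, hence holds pathwise for whatever data-dependent
working quantities occur.

The steps `t_i` do not involve the working quantities. Given the random effects they are centered
and independent, so `m^{-1/2} ∑ t_i` has second moment of the order of the mean of the `τ_i`, which
is `O(1/n_L)`. Since `E_i` has mean at most `φ p`, the remainders add up to `O_p(√m / n_L)`, which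
vanishes by `m / n_L² → 0`. The factor `1 + ‖Δ‖²` in the remainder is controlled by an a priori
bound (`IsPQLEstimate.norm_sub_le`). The `τ_i` are made nonrandom in
`CondDesign.exists_designBound`, by evaluating the design condition at a single favourable outcome.
-/

noncomputable section

namespace PQL

/-! ### Products of measures with densities -/

/-- A product of measures with integrable densities has the product density. -/
lemma pi_withDensity_ofReal {ι : Type*} [Fintype ι] (ν : Measure ℝ) [SigmaFinite ν]
    (f : ι → ℝ → ℝ) (hf0 : ∀ q y, 0 ≤ f q y) (hf : ∀ q, Integrable (f q) ν) :
    (Measure.pi fun _ : ι => ν).withDensity (fun y => ∏ q, ENNReal.ofReal (f q (y q))) =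
      Measure.pi fun q => ν.withDensity fun y => ENNReal.ofReal (f q y) := by
  have : ∀ q, IsFiniteMeasure (ν.withDensity fun y => ENNReal.ofReal (f q y)) := fun q =>
    isFiniteMeasure_withDensity_ofReal (hf q).2
  symm
  refine Measure.pi_eq fun s hs => ?_
  have hrect : MeasurableSet (Set.univ.pi s) := MeasurableSet.univ_pi hs
  rw [withDensity_apply _ hrect, ← lintegral_indicator hrect]
  -- The indicator of a box factors over the coordinates, so it can be absorbed into the individual
  -- densities and the integral splits as a product.
  have hind : ∀ y : ι → ℝ, (Set.univ.pi s).indicator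
      (fun y => ∏ q, ENNReal.ofReal (f q (y q))) y =
      ENNReal.ofReal (∏ q, (s q).indicator (f q) (y q)) := by
    intro y
    rw [ENNReal.ofReal_prod_of_nonneg
      (fun q _ => Set.indicator_nonneg (fun z _ => hf0 q z) _)]
    by_cases hy : y ∈ Set.univ.pi s
    · rw [Set.indicator_of_mem hy]
      refine Finset.prod_congr rfl fun q _ => ?_
      rw [Set.indicator_of_mem (hy q (Set.mem_univ q))]
    · rw [Set.indicator_of_notMem hy]
      simp only [Set.mem_univ_pi, not_forall] at hy
      obtain ⟨q, hq⟩ := hy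
      symm
      refine Finset.prod_eq_zero (Finset.mem_univ q) ?_
      rw [Set.indicator_of_notMem hq, ENNReal.ofReal_zero]
  simp_rw [hind]
  have hint : ∀ q, Integrable ((s q).indicator (f q)) ν := fun q => (hf q).indicator (hs q)
  rw [← ofReal_integral_eq_lintegral_ofReal (Integrable.fintype_prod hint)
      (ae_of_all _ fun y => Finset.prod_nonneg fun q _ =>
        Set.indicator_nonneg (fun z _ => hf0 q z) _),
    integral_fintype_prod_eq_prod,
    ENNReal.ofReal_prod_of_nonneg
      (fun q _ => integral_nonneg fun z => Set.indicator_nonneg (fun z _ => hf0 q z) _)]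
  refine Finset.prod_congr rfl fun q _ => ?_
  rw [withDensity_apply _ (hs q), ← lintegral_indicator (hs q),
    ofReal_integral_eq_lintegral_ofReal (hint q)
      (ae_of_all _ fun z => Set.indicator_nonneg (fun z _ => hf0 q z) _)]
  refine lintegral_congr fun z => ?_
  by_cases hz : z ∈ s q <;> simp [hz]

/-! ### Moments of the exponential family -/

section Family

variable {ν : Measure ℝ} {a : ℝ → ℝ} {c : ℝ → ℝ → ℝ} {φ : ℝ}

/-- The member of the exponential family with natural parameter `η`. -/
def familyMeasure (ν : Measure ℝ) (a : ℝ → ℝ) (c : ℝ → ℝ → ℝ) (φ η : ℝ) : Measure ℝ :=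
  ν.withDensity fun y => ENNReal.ofReal (density a c φ η y)

lemma density_pos (η y : ℝ) : 0 < density a c φ η y := Real.exp_pos _

lemma measurable_density (h : IsExpFamily ν a c φ) (η : ℝ) : Measurable (density a c φ η) := by
  have := h.1
  unfold density logDensity
  fun_prop

lemma integrable_density (h : IsExpFamily ν a c φ) (η : ℝ) : Integrable (density a c φ η) ν := by
  refine ⟨(measurable_density h η).aestronglyMeasurable, ?_⟩
  rw [hasFiniteIntegral_iff_ofReal (ae_of_all _ fun y => (density_pos η y).le), h.2 η]
  exact ENNReal.one_lt_top

lemma isProbabilityMeasure_familyMeasure (h : IsExpFamily ν a c φ) (η : ℝ) :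
    IsProbabilityMeasure (familyMeasure ν a c φ η) := by
  constructor
  rw [familyMeasure, withDensity_apply _ MeasurableSet.univ, Measure.restrict_univ, h.2 η]

/-- Exponential tilting by `t` stays in the family and moves the natural parameter to `η + φ t`. As
all real parameters are admissible, all exponential moments are finite. -/
lemma density_mul_exp (hφ : 0 < φ) (η t y : ℝ) :
    density a c φ η y * Real.exp (t * y) =
      Real.exp (φ⁻¹ * (a (η + φ * t) - a η)) * density a c φ (η + φ * t) y := by
  unfold density logDensity
  rw [← Real.exp_add, ← Real.exp_add]
  congr 1
  field_simp
  ring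

lemma integrable_exp_familyMeasure (h : IsExpFamily ν a c φ) (hφ : 0 < φ) (η t : ℝ) :
    Integrable (fun y => Real.exp (t * y)) (familyMeasure ν a c φ η) := by
  rw [familyMeasure, integrable_withDensity_iff_integrable_smul₀'
    (measurable_density h η).ennreal_ofReal.aemeasurable
    (ae_of_all _ fun y => ENNReal.ofReal_lt_top)]
  refine ((integrable_density h (η + φ * t)).const_mul
    (Real.exp (φ⁻¹ * (a (η + φ * t) - a η)))).congr (ae_of_all _ fun y => ?_)
  simp only
  rw [ENNReal.toReal_ofReal (density_pos η y).le, smul_eq_mul, density_mul_exp hφ]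

lemma integral_density (h : IsExpFamily ν a c φ) (η : ℝ) : ∫ y, density a c φ η y ∂ν = 1 := by
  rw [integral_eq_lintegral_of_nonneg_ae (ae_of_all _ fun y => (density_pos η y).le)
    (measurable_density h η).aestronglyMeasurable, h.2 η, ENNReal.toReal_one]

/-- The tilted density has total mass one, so only the normalizing factor survives integration. The
derivatives at `0` give the mean `a'(η)` and the variance `φ a''(η)`. -/
lemma cgf_familyMeasure (h : IsExpFamily ν a c φ) (hφ : 0 < φ) (η : ℝ) :
    cgf id (familyMeasure ν a c φ η) = fun t => φ⁻¹ * (a (η + φ * t) - a η) := by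
  ext t
  have : mgf id (familyMeasure ν a c φ η) t = Real.exp (φ⁻¹ * (a (η + φ * t) - a η)) := by
    rw [mgf, familyMeasure, integral_withDensity_eq_integral_toReal_smul
      (measurable_density h η).ennreal_ofReal (ae_of_all _ fun y => ENNReal.ofReal_lt_top)]
    calc _ = ∫ y, Real.exp (φ⁻¹ * (a (η + φ * t) - a η)) * density a c φ (η + φ * t) y ∂ν := by
          refine integral_congr_ae (ae_of_all _ fun y => ?_)
          simp only [id]
          rw [ENNReal.toReal_ofReal (density_pos η y).le, smul_eq_mul, density_mul_exp hφ]
      _ = _ := by rw [integral_const_mul, integral_density h, mul_one]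
  rw [cgf, this, Real.log_exp]

lemma zero_mem_interior_integrableExpSet (h : IsExpFamily ν a c φ) (hφ : 0 < φ) (η : ℝ) :
    0 ∈ interior (integrableExpSet id (familyMeasure ν a c φ η)) := by
  have : integrableExpSet id (familyMeasure ν a c φ η) = Set.univ :=
    Set.eq_univ_of_forall fun t => integrable_exp_familyMeasure h hφ η t
  rw [this, interior_univ]
  trivial

lemma memLp_two_familyMeasure (h : IsExpFamily ν a c φ) (hφ : 0 < φ) (η : ℝ) :
    MemLp id 2 (familyMeasure ν a c φ η) := by
  simpa using memLp_of_mem_interior_integrableExpSet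
    (zero_mem_interior_integrableExpSet h hφ η) 2

lemma hasDerivAt_of_contDiff_three (ha : ContDiff ℝ 3 a) (u : ℝ) : HasDerivAt a (deriv a u) u :=
  ((ha.differentiable (by norm_num)) u).hasDerivAt

lemma hasDerivAt_deriv_of_contDiff_three (ha : ContDiff ℝ 3 a) (u : ℝ) :
    HasDerivAt (deriv a) (iteratedDeriv 2 a u) u := by
  have hd : Differentiable ℝ (iteratedDeriv 1 a) := ha.differentiable_iteratedDeriv 1 (by norm_num)
  rw [iteratedDeriv_one] at hd
  have := (hd u).hasDerivAt
  rwa [← iteratedDeriv_one, ← iteratedDeriv_succ, iteratedDeriv_one] at this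

lemma hasDerivAt_cumulant_line (ha : ContDiff ℝ 3 a) (hφ : 0 < φ) (η t : ℝ) :
    HasDerivAt (fun t => φ⁻¹ * (a (η + φ * t) - a η)) (deriv a (η + φ * t)) t := by
  have h1 : HasDerivAt (fun t => η + φ * t) φ t := by
    simpa using ((hasDerivAt_id t).const_mul φ).const_add η
  have h2 := ((hasDerivAt_of_contDiff_three ha (η + φ * t)).comp t h1).sub_const (a η)
  have h3 := h2.const_mul φ⁻¹
  rwa [mul_comm (deriv a _), inv_mul_cancel_left₀ hφ.ne'] at h3

lemma integral_familyMeasure (ha : ContDiff ℝ 3 a) (h : IsExpFamily ν a c φ) (hφ : 0 < φ) (η : ℝ) :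
    ∫ y, y ∂(familyMeasure ν a c φ η) = deriv a η := by
  have := isProbabilityMeasure_familyMeasure h η
  have h0 := deriv_cgf_zero (zero_mem_interior_integrableExpSet h hφ η)
  rw [cgf_familyMeasure h hφ, (hasDerivAt_cumulant_line ha hφ η 0).deriv] at h0
  simpa using h0.symm

lemma variance_familyMeasure (ha : ContDiff ℝ 3 a) (h : IsExpFamily ν a c φ) (hφ : 0 < φ) (η : ℝ) :
    Var[id; familyMeasure ν a c φ η] = φ * iteratedDeriv 2 a η := by
  have := isProbabilityMeasure_familyMeasure h η
  have h0 := iteratedDeriv_two_cgf_eq_integral (zero_mem_interior_integrableExpSet h hφ η)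
  rw [variance_eq_integral aemeasurable_id]
  have hd : deriv (fun t => φ⁻¹ * (a (η + φ * t) - a η)) = fun t => deriv a (η + φ * t) :=
    funext fun t => (hasDerivAt_cumulant_line ha hφ η t).deriv
  have hd2 : iteratedDeriv 2 (fun t => φ⁻¹ * (a (η + φ * t) - a η)) 0 =
      φ * iteratedDeriv 2 a η := by
    rw [iteratedDeriv_succ, iteratedDeriv_one, hd]
    have h1 : HasDerivAt (fun t => η + φ * t) φ 0 := by
      simpa using ((hasDerivAt_id (0 : ℝ)).const_mul φ).const_add η
    have h2 := (hasDerivAt_deriv_of_contDiff_three ha (η + φ * 0)).comp 0 h1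
    rw [mul_zero, add_zero, mul_comm] at h2
    exact h2.deriv
  have hmean : ∫ y, id y ∂(familyMeasure ν a c φ η) = deriv a η := integral_familyMeasure ha h hφ η
  rw [cgf_familyMeasure h hφ, hd2, hd] at h0
  rw [h0, hmean]
  simp

/-- Second moment of a linear combination of centered independent responses. -/
lemma lintegral_sq_sum_centered {ι : Type*} [Fintype ι] (ha : ContDiff ℝ 3 a)
    (h : IsExpFamily ν a c φ) (hφ : 0 < φ)
    (η d : ι → ℝ) :
    ∫⁻ y, ENNReal.ofReal ((∑ q, d q * (y q - deriv a (η q))) ^ 2)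
      ∂(Measure.pi fun q => familyMeasure ν a c φ (η q)) =
    ENNReal.ofReal (φ * ∑ q, d q ^ 2 * iteratedDeriv 2 a (η q)) := by
  have hP : ∀ q, IsProbabilityMeasure (familyMeasure ν a c φ (η q)) := fun q =>
    isProbabilityMeasure_familyMeasure h (η q)
  set X : ι → ℝ → ℝ := fun q z => d q * (z - deriv a (η q)) with hX
  have hXL : ∀ q, MemLp (X q) 2 (familyMeasure ν a c φ (η q)) := fun q =>
    ((memLp_two_familyMeasure h hφ (η q)).sub (memLp_const _)).const_mul _
  have hXpi : ∀ q, MemLp (fun y : ι → ℝ => X q (y q)) 2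
      (Measure.pi fun q => familyMeasure ν a c φ (η q)) := fun q =>
    (hXL q).comp_measurePreserving (measurePreserving_eval _ q)
  have hmean : ∀ q, ∫ z, X q z ∂(familyMeasure ν a c φ (η q)) = 0 := by
    intro q
    have hi : Integrable (fun z : ℝ => z) (familyMeasure ν a c φ (η q)) :=
      (memLp_two_familyMeasure h hφ (η q)).integrable (by norm_num)
    simp only [hX]
    rw [integral_const_mul, integral_sub hi (integrable_const _),
      integral_familyMeasure ha h hφ]
    simp
  -- Independence removes the cross terms; the sum is centered, so its variance is its second
  -- moment.
  have hvar := variance_sum_pi hXL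
  have hsumL : MemLp (fun y : ι → ℝ => ∑ q, X q (y q)) 2
      (Measure.pi fun q => familyMeasure ν a c φ (η q)) := memLp_finsetSum _ fun q _ => hXpi q
  have hmean0 : ∫ y, ∑ q, X q (y q) ∂(Measure.pi fun q => familyMeasure ν a c φ (η q)) = 0 := by
    rw [integral_finsetSum _ fun q _ => (hXpi q).integrable (by norm_num)]
    refine Finset.sum_eq_zero fun q _ => ?_
    rw [← hmean q]
    exact integral_comp_eval (μ := fun q => familyMeasure ν a c φ (η q))
      (hXL q).aestronglyMeasurable
  rw [← ofReal_integral_eq_lintegral_ofReal hsumL.integrable_sq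
    (ae_of_all _ fun y => sq_nonneg _)]
  congr 1
  have hfun : (∑ q, fun y : ι → ℝ => X q (y q)) = fun y => ∑ q, X q (y q) := by
    ext y; simp
  rw [hfun, variance_eq_integral hsumL.aestronglyMeasurable.aemeasurable, hmean0] at hvar
  simp only [sub_zero] at hvar
  rw [hvar, Finset.mul_sum]
  refine Finset.sum_congr rfl fun q _ => ?_
  simp only [hX]
  have hshift : Var[fun z => z - deriv a (η q); familyMeasure ν a c φ (η q)] =
      Var[id; familyMeasure ν a c φ (η q)] :=
    variance_sub_const aestronglyMeasurable_id _
  rw [variance_const_mul, hshift, variance_familyMeasure ha h hφ (η q)]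
  ring

end Family

/-! ### The law of the mixed model -/

section Law

variable {p : ℕ} {Ω : Type*} [MeasurableSpace Ω] {μ : Measure Ω}
  {ν : Measure ℝ} {a : ℝ → ℝ} {c : ℝ → ℝ → ℝ} {φ : ℝ} {β : Vec p}
  {G : Matrix (Fin p) (Fin p) ℝ} {m : ℕ} {n : ℕ → ℕ} {x : ℕ → ℕ → Vec p}
  {b : ℕ → Ω → Vec p} {y : ℕ → ℕ → Ω → ℝ}

lemma continuous_linPred (v β : Vec p) : Continuous (linPred v β) := by
  unfold linPred
  fun_prop

lemma HasGLMMLaw.aemeasurable_pair (h : HasGLMMLaw μ ν a c φ β G m n x b y) :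
    AEMeasurable (fun ω => ((fun i : Fin m => b i ω),
      (fun q : (Σ i : Fin m, Fin (n i)) => y q.1 q.2 ω))) μ := by
  refine AEMeasurable.prodMk (aemeasurable_pi_lambda _ fun i => h.1 i i.2)
    (aemeasurable_pi_lambda _ fun q => h.2.1 q.1 q.1.2 q.2 q.2.2)

variable [SigmaFinite ν]

/-- Integration against the model: first over the responses given the random effects, then over
the random effects. -/
lemma HasGLMMLaw.lintegral_eq (h : HasGLMMLaw μ ν a c φ β G m n x b y)
    (hfam : IsExpFamily ν a c φ) (ha : Continuous a)
    (F : (Fin m → Vec p) × ((Σ i : Fin m, Fin (n i)) → ℝ) → ℝ≥0∞) (hF : Measurable F) :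
    ∫⁻ ω, F ((fun i : Fin m => b i ω), (fun q : (Σ i : Fin m, Fin (n i)) => y q.1 q.2 ω)) ∂μ =
      ∫⁻ B, ∫⁻ Y, F (B, Y)
        ∂(Measure.pi fun q : (Σ i : Fin m, Fin (n i)) =>
          familyMeasure ν a c φ (linPred (x q.1 q.2) β (B q.1)))
        ∂(Measure.pi fun _ : Fin m => multivariateGaussian (0 : Vec p) G) := by
  have hc := hfam.1
  have hdens : Measurable (fun w : (Fin m → Vec p) × ((Σ i : Fin m, Fin (n i)) → ℝ) =>
      ∏ q : (Σ i : Fin m, Fin (n i)),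
        ENNReal.ofReal (density a c φ (linPred (x q.1 q.2) β (w.1 q.1)) (w.2 q))) := by
    refine Finset.measurable_prod _ fun q _ => Measurable.ennreal_ofReal ?_
    have hl : Measurable (fun w : (Fin m → Vec p) × ((Σ i : Fin m, Fin (n i)) → ℝ) =>
        linPred (x q.1 q.2) β (w.1 q.1)) :=
      (continuous_linPred _ _).measurable.comp (by fun_prop)
    have hal := ha.measurable.comp hl
    have hcl : Measurable (fun w : (Fin m → Vec p) × ((Σ i : Fin m, Fin (n i)) → ℝ) =>
        c (w.2 q) φ) := hc.comp (by fun_prop)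
    unfold density logDensity
    refine Real.measurable_exp.comp (((Measurable.sub ?_ hal).const_mul _).add hcl)
    exact (by fun_prop : Measurable
      (fun w : (Fin m → Vec p) × ((Σ i : Fin m, Fin (n i)) → ℝ) => w.2 q)).mul hl
  rw [← lintegral_map' (f := F) hF.aemeasurable h.aemeasurable_pair, h.2.2,
    lintegral_withDensity_eq_lintegral_mul _ hdens hF,
    lintegral_prod _ (hdens.mul hF).aemeasurable]
  refine lintegral_congr fun B => ?_
  -- For fixed random effects the joint density factors, so the responses follow a product of family
  -- members.
  have := pi_withDensity_ofReal ν
    (fun (q : (Σ i : Fin m, Fin (n i))) => density a c φ (linPred (x q.1 q.2) β (B q.1)))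
    (fun q y => (density_pos _ y).le) (fun q => integrable_density hfam _)
  unfold familyMeasure
  rw [← this]
  exact (lintegral_withDensity_eq_lintegral_mul _
    (hdens.comp measurable_prodMk_left) (hF.comp measurable_prodMk_left)).symm

/-- Second moments of linear combinations of the centered responses, with weights depending on
the random effects. -/
lemma HasGLMMLaw.lintegral_sum_sq_le {κ : Type*} [Fintype κ]
    (h : HasGLMMLaw μ ν a c φ β G m n x b y)
    (hfam : IsExpFamily ν a c φ) (hφ : 0 < φ) (ha : ContDiff ℝ 3 a)
    (d : κ → (Σ i : Fin m, Fin (n i)) → (Fin m → Vec p) → ℝ) (hd : ∀ l q, Measurable (d l q))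
    (C : ℝ)
    (hC : ∀ B : Fin m → Vec p,
      ∑ l, ∑ q, d l q B ^ 2 * iteratedDeriv 2 a (linPred (x q.1 q.2) β (B q.1)) ≤ C) :
    ∫⁻ ω, ENNReal.ofReal (∑ l, (∑ q : (Σ i : Fin m, Fin (n i)), d l q (fun i : Fin m => b i ω) *
      (y q.1 q.2 ω - deriv a (linPred (x q.1 q.2) β (b q.1 ω)))) ^ 2) ∂μ ≤
      ENNReal.ofReal (φ * C) := by
  have hda : Continuous (deriv a) := ha.continuous_deriv (by norm_num)
  have hF : ∀ l, Measurable (fun w : (Fin m → Vec p) × ((Σ i : Fin m, Fin (n i)) → ℝ) =>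
      (∑ q : (Σ i : Fin m, Fin (n i)), d l q w.1 *
        (w.2 q - deriv a (linPred (x q.1 q.2) β (w.1 q.1)))) ^ 2) := by
    intro l
    refine Measurable.pow_const (Finset.measurable_sum _ fun q _ => ?_) 2
    refine ((hd l q).comp measurable_fst).mul (Measurable.sub (by fun_prop) ?_)
    exact (hda.measurable.comp (continuous_linPred _ _).measurable).comp (by fun_prop)
  have hpm : IsProbabilityMeasure
      (Measure.pi fun _ : Fin m => multivariateGaussian (0 : Vec p) G) := inferInstance
  -- Nonnegativity of `φ a''` is automatic, because it is a variance.
  have hw : ∀ η, 0 ≤ φ * iteratedDeriv 2 a η := fun η => by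
    rw [← variance_familyMeasure ha hfam hφ η]
    exact variance_nonneg _ _
  rw [h.lintegral_eq hfam ha.continuous
    (fun w => ENNReal.ofReal (∑ l, (∑ q : (Σ i : Fin m, Fin (n i)), d l q w.1 *
        (w.2 q - deriv a (linPred (x q.1 q.2) β (w.1 q.1)))) ^ 2))
    (Finset.measurable_sum _ fun l _ => hF l).ennreal_ofReal]
  calc _ ≤ ∫⁻ _, ENNReal.ofReal (φ * C)
        ∂(Measure.pi fun _ : Fin m => multivariateGaussian (0 : Vec p) G) := by
        refine lintegral_mono fun B => ?_
        simp_rw [ENNReal.ofReal_sum_of_nonneg fun l (_ : l ∈ Finset.univ) => sq_nonneg _]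
        have hFB : ∀ l, Measurable (fun Y : (Σ i : Fin m, Fin (n i)) → ℝ =>
            ENNReal.ofReal ((∑ q : (Σ i : Fin m, Fin (n i)), d l q B *
              (Y q - deriv a (linPred (x q.1 q.2) β (B q.1)))) ^ 2)) := fun l =>
          ((hF l).comp (measurable_prodMk_left (x := B))).ennreal_ofReal
        rw [lintegral_finsetSum _ fun l _ => hFB l]
        simp_rw [lintegral_sq_sum_centered ha hfam hφ
          (fun q : (Σ i : Fin m, Fin (n i)) => linPred (x q.1 q.2) β (B q.1)) (fun q => d _ q B)]
        rw [← ENNReal.ofReal_sum_of_nonneg, ← Finset.mul_sum]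
        · exact ENNReal.ofReal_le_ofReal (mul_le_mul_of_nonneg_left (hC B) hφ.le)
        · intro l _
          rw [Finset.mul_sum]
          refine Finset.sum_nonneg fun q _ => ?_
          rw [mul_left_comm]
          exact mul_nonneg (sq_nonneg _) (hw _)
    _ = _ := by simp

/-- Each conditional law of the responses has mass one, so integrating them out leaves the Gaussian
product. -/
lemma HasGLMMLaw.map_randomEffects (h : HasGLMMLaw μ ν a c φ β G m n x b y)
    (hfam : IsExpFamily ν a c φ) (ha : Continuous a) :
    μ.map (fun ω => fun i : Fin m => b i ω) =
      Measure.pi fun _ : Fin m => multivariateGaussian (0 : Vec p) G := by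
  ext s hs
  have hb : AEMeasurable (fun ω => fun i : Fin m => b i ω) μ :=
    aemeasurable_pi_lambda _ fun i => h.1 i i.2
  have hP : ∀ η, IsProbabilityMeasure (familyMeasure ν a c φ η) :=
    isProbabilityMeasure_familyMeasure hfam
  have := h.lintegral_eq hfam ha (fun w => s.indicator 1 w.1)
    ((measurable_one.indicator hs).comp measurable_fst)
  simp only [lintegral_const, measure_univ, mul_one] at this
  rw [lintegral_indicator_one hs] at this
  rw [← this, ← lintegral_indicator_one hs,
    lintegral_map' (measurable_one.indicator hs).aemeasurable hb]

lemma HasGLMMLaw.map_randomEffect (h : HasGLMMLaw μ ν a c φ β G m n x b y)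
    (hfam : IsExpFamily ν a c φ) (ha : Continuous a) (i : Fin m) :
    μ.map (b i) = multivariateGaussian (0 : Vec p) G := by
  have hb : AEMeasurable (fun ω => fun i : Fin m => b i ω) μ :=
    aemeasurable_pi_lambda _ fun i => h.1 i i.2
  have h1 := (measurePreserving_eval
    (fun _ : Fin m => multivariateGaussian (0 : Vec p) G) i).map_eq
  rw [← h.map_randomEffects hfam ha,
    AEMeasurable.map_map_of_aemeasurable (measurable_pi_apply i).aemeasurable hb] at h1
  exact h1

lemma lintegral_norm_sq_multivariateGaussian_lt_top (G : Matrix (Fin p) (Fin p) ℝ) :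
    ∫⁻ v, ENNReal.ofReal (‖v‖ ^ 2) ∂(multivariateGaussian (0 : Vec p) G) < ∞ := by
  have h : MemLp id 2 (multivariateGaussian (0 : Vec p) G) := IsGaussian.memLp_two_id
  have h2 := h.norm.integrable_sq
  exact (hasFiniteIntegral_iff_ofReal (ae_of_all _ fun v => sq_nonneg _)).1 h2.2

lemma HasGLMMLaw.lintegral_norm_sq (h : HasGLMMLaw μ ν a c φ β G m n x b y)
    (hfam : IsExpFamily ν a c φ) (ha : Continuous a) (i : Fin m) :
    ∫⁻ ω, ENNReal.ofReal (‖b i ω‖ ^ 2) ∂μ =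
      ∫⁻ v, ENNReal.ofReal (‖v‖ ^ 2) ∂(multivariateGaussian (0 : Vec p) G) := by
  rw [← h.map_randomEffect hfam ha i, lintegral_map' (by fun_prop) (h.1 i i.2)]

/-- Gaussian stability, via characteristic functions: the power `m` from the product cancels the
factor `1/m` that the scaling produces in the quadratic form. The law is exact at every stage. -/
lemma HasGLMMLaw.map_normalized_sum (h : HasGLMMLaw μ ν a c φ β G m n x b y)
    (hfam : IsExpFamily ν a c φ) (ha : Continuous a) (hG : G.PosSemidef) (hm : 0 < m) :
    μ.map (fun ω => (√(m : ℝ))⁻¹ • ∑ i : Fin m, b i ω) = multivariateGaussian (0 : Vec p) G := by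
  have hb : AEMeasurable (fun ω => fun i : Fin m => b i ω) μ :=
    aemeasurable_pi_lambda _ fun i => h.1 i i.2
  have hS : Measurable (fun B : Fin m → Vec p => ∑ i, B i) := by fun_prop
  have hmap : μ.map (fun ω => (√(m : ℝ))⁻¹ • ∑ i : Fin m, b i ω) =
      ((Measure.pi fun _ : Fin m => multivariateGaussian (0 : Vec p) G).map
        (fun B => ∑ i, B i)).map (fun v => (√(m : ℝ))⁻¹ • v) := by
    rw [← h.map_randomEffects hfam ha, AEMeasurable.map_map_of_aemeasurable hS.aemeasurable hb,
      AEMeasurable.map_map_of_aemeasurable (by fun_prop) (hS.comp_aemeasurable hb)]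
    rfl
  have hp1 : IsProbabilityMeasure ((Measure.pi fun _ : Fin m =>
      multivariateGaussian (0 : Vec p) G).map (fun B => ∑ i, B i)) :=
    Measure.isProbabilityMeasure_map hS.aemeasurable
  have hp2 : IsProbabilityMeasure (((Measure.pi fun _ : Fin m =>
      multivariateGaussian (0 : Vec p) G).map (fun B => ∑ i, B i)).map
        (fun v => (√(m : ℝ))⁻¹ • v)) :=
    Measure.isProbabilityMeasure_map (by fun_prop)
  rw [hmap]
  refine Measure.ext_of_charFun ?_
  ext t
  rw [charFun_map_smul, charFun_map_sum_pi_eq_prod, Finset.prod_apply]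
  simp only [charFun_multivariateGaussian hG, Finset.prod_const, Finset.card_univ,
    Fintype.card_fin]
  rw [← Complex.exp_nat_mul]
  congr 1
  have hm0 : (0 : ℝ) < m := by exact_mod_cast hm
  have hq : (√(m : ℝ))⁻¹ * (√(m : ℝ))⁻¹ = (m : ℝ)⁻¹ := by
    rw [← mul_inv, Real.mul_self_sqrt hm0.le]
  have hquad : ((√(m : ℝ))⁻¹ • t).ofLp ⬝ᵥ G *ᵥ ((√(m : ℝ))⁻¹ • t).ofLp =
      (m : ℝ)⁻¹ * (t.ofLp ⬝ᵥ G *ᵥ t.ofLp) := by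
    rw [WithLp.ofLp_smul, Matrix.mulVec_smul, smul_dotProduct, dotProduct_smul, smul_eq_mul,
      smul_eq_mul, ← mul_assoc, hq]
  rw [hquad]
  have : (m : ℂ) ≠ 0 := by exact_mod_cast hm.ne'
  simp only [inner_zero_right, Complex.ofReal_zero, zero_mul, zero_sub]
  push_cast
  field_simp

end Law

/-! ### Quadratic forms -/

section QuadraticForms

variable {p : ℕ}

lemma inner_eq_dotProduct (u v : Vec p) : inner ℝ u v = u.ofLp ⬝ᵥ v.ofLp := by
  rw [EuclideanSpace.inner_eq_star_dotProduct, dotProduct_comm]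
  simp

lemma dotProduct_mulVec_comm {W : Matrix (Fin p) (Fin p) ℝ} (hW : W.IsHermitian)
    (u v : Fin p → ℝ) : u ⬝ᵥ W *ᵥ v = v ⬝ᵥ W *ᵥ u := by
  have hWt : Wᵀ = W := by simpa using hW.eq
  rw [Matrix.dotProduct_mulVec, dotProduct_comm, ← Matrix.mulVec_transpose, hWt]

/-- Cauchy-Schwarz inequality for a positive semidefinite matrix. -/
lemma sq_dotProduct_mulVec_le {W : Matrix (Fin p) (Fin p) ℝ} (hW : W.PosSemidef)
    (u v : Fin p → ℝ) :
    (u ⬝ᵥ W *ᵥ v) ^ 2 ≤ (u ⬝ᵥ W *ᵥ u) * (v ⬝ᵥ W *ᵥ v) := by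
  have := LinearMap.BilinForm.apply_sq_le_of_symm (Matrix.toBilin' W)
    (fun v => by simpa [Matrix.toBilin'_apply'] using hW.dotProduct_mulVec_nonneg v)
    ⟨fun u v => by simpa [Matrix.toBilin'_apply'] using
      dotProduct_mulVec_comm hW.isHermitian u v⟩ u v
  simpa [Matrix.toBilin'_apply'] using this

/-- Write `v_r = (W⁻¹ e_r)ᵀ W v`. Cauchy-Schwarz for the form `W` gives `v_r² ≤ (W⁻¹)_{rr} · vᵀWv`;
sum over `r`. -/
lemma norm_sq_le_trace_inv_mul {W : Matrix (Fin p) (Fin p) ℝ} (hW : W.PosDef) (v : Vec p) :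
    ‖v‖ ^ 2 ≤ W⁻¹.trace * (v.ofLp ⬝ᵥ W *ᵥ v.ofLp) := by
  have hdet : IsUnit W.det := (Matrix.isUnit_iff_isUnit_det W).1 hW.isUnit
  rw [EuclideanSpace.real_norm_sq_eq, Matrix.trace, Finset.sum_mul]
  refine Finset.sum_le_sum fun r _ => ?_
  have hcs := sq_dotProduct_mulVec_le hW.posSemidef (W⁻¹ *ᵥ Pi.single r 1) v.ofLp
  have hWt : (W⁻¹)ᵀ = W⁻¹ := by simpa using hW.inv.isHermitian.eq
  have h1 : ∀ u : Fin p → ℝ, (W⁻¹ *ᵥ Pi.single r 1) ⬝ᵥ W *ᵥ u = u r := by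
    intro u
    rw [← hWt, Matrix.mulVec_transpose, ← Matrix.dotProduct_mulVec, Matrix.mulVec_mulVec,
      Matrix.nonsing_inv_mul _ hdet, Matrix.one_mulVec, single_one_dotProduct]
  rw [h1, h1] at hcs
  simpa using hcs

lemma trace_le_of_wellConditioned {c₁ : ℝ} {K : Matrix (Fin p) (Fin p) ℝ}
    (h : WellConditioned c₁ K) : K.trace ≤ p * c₁⁻¹ := by
  have hK := h.1.isHermitian
  rw [hK.trace_eq_sum_eigenvalues]
  calc _ ≤ ∑ _r : Fin p, c₁⁻¹ := by
        refine Finset.sum_le_sum fun r _ => ?_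
        simpa using (h.2 _ (hK.eigenvalues_mem_spectrum_real r)).2
    _ = _ := by simp

end QuadraticForms

/-! ### Weighted Gram matrices -/

section Gram

variable {p : ℕ} {a : ℝ → ℝ} {φ c₀ : ℝ} {n : ℕ} {x : ℕ → Vec p} {β b : Vec p}

lemma designMatrix_mulVec (v : Vec p) (j : Fin n) :
    (designMatrix n x *ᵥ v.ofLp) j = inner ℝ (x j) v := by
  rw [inner_eq_dotProduct]
  rfl

lemma dotProduct_weightedGram (u v : Vec p) :
    u.ofLp ⬝ᵥ (weightedGram a φ n x β b *ᵥ v.ofLp) =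
      φ⁻¹ * ∑ j : Fin n, iteratedDeriv 2 a (linPred (x j) β b) *
        (inner ℝ (x j) u * inner ℝ (x j) v) := by
  rw [weightedGram, ← Matrix.mulVec_mulVec, ← Matrix.mulVec_mulVec, Matrix.dotProduct_mulVec,
    Matrix.vecMul_transpose, dotProduct, Finset.mul_sum]
  refine Finset.sum_congr rfl fun j _ => ?_
  rw [Matrix.mulVec_diagonal, designMatrix_mulVec, designMatrix_mulVec]
  ring

lemma posSemidef_weightedGram (hφ : 0 < φ) (ha : ∀ η, 0 ≤ iteratedDeriv 2 a η) :
    (weightedGram a φ n x β b).PosSemidef := by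
  have hd : (Matrix.diagonal fun j : Fin n =>
      φ⁻¹ * iteratedDeriv 2 a (linPred (x j) β b)).PosSemidef :=
    Matrix.PosSemidef.diagonal fun j => mul_nonneg (inv_nonneg.2 hφ.le) (ha _)
  have := hd.conjTranspose_mul_mul_same (designMatrix n x)
  rwa [Matrix.conjTranspose_eq_transpose_of_trivial] at this

/-- A Gram matrix whose inverse exists bounds norms by the quadratic form of the design. -/
lemma norm_sq_le_trace_mul_sum_sq (hφ : 0 < φ) (h0 : ∀ η, 0 ≤ iteratedDeriv 2 a η)
    (h1 : ∀ η, iteratedDeriv 2 a η ≤ c₀⁻¹) (hu : IsUnit (weightedGram a φ n x β b)) (v : Vec p) :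
    ‖v‖ ^ 2 ≤ (weightedGram a φ n x β b)⁻¹.trace * (φ⁻¹ * c₀⁻¹) *
      ∑ j : Fin n, inner ℝ (x j) v ^ 2 := by
  have hpd : (weightedGram a φ n x β b).PosDef :=
    (posSemidef_weightedGram hφ h0).posDef_iff_isUnit.2 hu
  refine (norm_sq_le_trace_inv_mul hpd v).trans ?_
  rw [dotProduct_weightedGram, mul_assoc, mul_assoc]
  refine mul_le_mul_of_nonneg_left ?_ hpd.inv.posSemidef.trace_nonneg
  refine mul_le_mul_of_nonneg_left ?_ (inv_nonneg.2 hφ.le)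
  rw [Finset.mul_sum]
  refine Finset.sum_le_sum fun j _ => ?_
  rw [← sq]
  exact mul_le_mul_of_nonneg_right (h1 _) (sq_nonneg _)

lemma trace_invInfo (hn : 0 < n) :
    (invInfo a φ n x β b).trace = n * (weightedGram a φ n x β b)⁻¹.trace := by
  have hn' : (n : ℝ) ≠ 0 := by exact_mod_cast hn.ne'
  have : (invInfo a φ n x β b) = (n : ℝ) • (weightedGram a φ n x β b)⁻¹ := by
    unfold invInfo
    by_cases hu : IsUnit (weightedGram a φ n x β b).det
    · have := Matrix.inv_smul' (A := weightedGram a φ n x β b)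
        (Units.mk0 ((n : ℝ)⁻¹) (inv_ne_zero hn')) hu
      simpa [Units.smul_def] using this
    -- For a singular Gram matrix both inverses are `0` by convention, so the identity persists.
    · rw [Matrix.nonsing_inv_apply_not_isUnit _ hu, smul_zero,
        Matrix.nonsing_inv_apply_not_isUnit]
      rw [Matrix.det_smul, IsUnit.mul_iff, not_and_or]
      exact Or.inr hu
  rw [this, Matrix.trace_smul, smul_eq_mul]

/-- The design is nondegenerate: `τ⁻¹ ‖v‖² ≤ ∑ ⟨x_j, v⟩²`. -/
def DesignBound (n : ℕ) (x : ℕ → Vec p) (τ : ℝ) : Prop :=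
  ∀ v : Vec p, ‖v‖ ^ 2 ≤ τ * ∑ j : Fin n, inner ℝ (x j) v ^ 2

/-- This transfers a nonrandom bound on the unweighted design to weights evaluated at arbitrary
random parameters. -/
lemma DesignBound.le_weighted {τ : ℝ} (h : DesignBound n x τ) (hτ : 0 ≤ τ) (hc₀ : 0 < c₀)
    (w : Fin n → ℝ) (hw : ∀ j, c₀ ≤ w j) (v : Vec p) :
    ‖v‖ ^ 2 ≤ τ * c₀⁻¹ * ∑ j : Fin n, w j * inner ℝ (x j) v ^ 2 := by
  refine (h v).trans ?_
  rw [mul_assoc]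
  refine mul_le_mul_of_nonneg_left ?_ hτ
  rw [Finset.mul_sum]
  refine Finset.sum_le_sum fun j _ => ?_
  rw [← mul_assoc]
  refine le_mul_of_one_le_left (sq_nonneg _) ?_
  rw [inv_mul_eq_div, one_le_div hc₀]
  exact hw j

/-- Invertibility thus holds at every value of the random effect, not just almost surely, which
makes the influence vectors continuous functions of it. -/
lemma DesignBound.posDef_weightedGram {τ : ℝ} (h : DesignBound n x τ) (hτ : 0 ≤ τ) (hc₀ : 0 < c₀)
    (h0 : ∀ η, c₀ ≤ iteratedDeriv 2 a η) : (weightedGram a 1 n x β b).PosDef := by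
  have hps : (weightedGram a 1 n x β b).PosSemidef :=
    posSemidef_weightedGram one_pos fun η => hc₀.le.trans (h0 η)
  refine Matrix.PosDef.of_dotProduct_mulVec_pos hps.isHermitian fun v hv => ?_
  refine lt_of_le_of_ne (hps.dotProduct_mulVec_nonneg v) fun heq => hv ?_
  have hb := h.le_weighted hτ hc₀ (fun j => iteratedDeriv 2 a (linPred (x j) β b))
    (fun j => h0 _) (WithLp.toLp 2 v)
  have hq := dotProduct_weightedGram (a := a) (φ := 1) (n := n) (x := x) (β := β) (b := b)
    (WithLp.toLp 2 v) (WithLp.toLp 2 v)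
  simp only [star_trivial] at heq
  rw [← heq, inv_one, one_mul] at hq
  simp_rw [← sq] at hq
  rw [← hq, mul_zero] at hb
  have hn0 : ‖(WithLp.toLp 2 v : Vec p)‖ = 0 := by
    have := norm_nonneg (WithLp.toLp 2 v : Vec p)
    nlinarith
  have := norm_eq_zero.1 hn0
  simpa using congrArg WithLp.ofLp this

/-- The vector `(Xᵀ W X)⁻¹ x_j`, with weights evaluated at the true parameters. -/
def influence (a : ℝ → ℝ) (n : ℕ) (x : ℕ → Vec p) (β b : Vec p) (j : ℕ) : Vec p :=
  WithLp.toLp 2 ((weightedGram a 1 n x β b)⁻¹ *ᵥ (x j).ofLp)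

lemma sum_weight_inner_influence (hpd : (weightedGram a 1 n x β b).PosDef) (j : ℕ) (v : Vec p) :
    ∑ l : Fin n, iteratedDeriv 2 a (linPred (x l) β b) *
      (inner ℝ (x l) v * inner ℝ (x l) (influence a n x β b j)) = inner ℝ (x j) v := by
  have hdet := (Matrix.isUnit_iff_isUnit_det _).1 hpd.isUnit
  have := dotProduct_weightedGram (a := a) (φ := 1) (n := n) (x := x) (β := β) (b := b)
    v (influence a n x β b j)
  rw [inv_one, one_mul] at this
  rw [← this, influence, Matrix.mulVec_mulVec, Matrix.mul_nonsing_inv _ hdet, Matrix.one_mulVec,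
    ← inner_eq_dotProduct, real_inner_comm]

/-- The sum is the trace of the hat matrix `X M⁻¹ Xᵀ D`; by cyclicity it is the trace of the `p × p`
identity. -/
lemma sum_leverage (hpd : (weightedGram a 1 n x β b).PosDef) :
    ∑ l : Fin n, iteratedDeriv 2 a (linPred (x l) β b) *
      inner ℝ (x l) (influence a n x β b l) = p := by
  have hdet := (Matrix.isUnit_iff_isUnit_det _).1 hpd.isUnit
  set M := weightedGram a 1 n x β b with hM
  set X := designMatrix n x
  set D := Matrix.diagonal (fun j : Fin n => (1 : ℝ)⁻¹ * iteratedDeriv 2 a (linPred (x j) β b))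
    with hD
  have hMX : M = Xᵀ * D * X := rfl
  have h1 : (D * (X * M⁻¹ * Xᵀ)).trace = p := by
    rw [Matrix.mul_assoc, Matrix.trace_mul_comm, Matrix.mul_assoc, Matrix.mul_assoc,
      Matrix.trace_mul_comm, Matrix.mul_assoc, Matrix.mul_assoc, ← Matrix.mul_assoc Xᵀ, ← hMX,
      Matrix.nonsing_inv_mul _ hdet]
    simp
  rw [← h1, Matrix.trace]
  refine Finset.sum_congr rfl fun l _ => ?_
  rw [Matrix.diag_apply, hD, Matrix.diagonal_mul, inv_one, one_mul]
  congr 1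
  rw [← designMatrix_mulVec, influence, Matrix.mulVec_mulVec]
  rfl

end Gram

/-! ### Scoring steps -/

section Step

variable {p : ℕ} {a : ℝ → ℝ} {c₀ τ : ℝ} {n : ℕ} {x : ℕ → Vec p} {β b : Vec p}

lemma continuous_influence (ha : ContDiff ℝ 3 a)
    (hpd : ∀ b, (weightedGram a 1 n x β b).PosDef) (j : ℕ) :
    Continuous fun b => influence a n x β b j := by
  have hM : Continuous fun b => weightedGram a 1 n x β b := by
    unfold weightedGram
    refine (continuous_const.matrix_mul (Continuous.matrix_diagonal ?_)).matrix_mul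
      continuous_const
    refine continuous_pi fun l => continuous_const.mul ?_
    exact (ha.continuous_iteratedDeriv 2 (by norm_num)).comp (continuous_linPred _ _)
  have hinv : Continuous fun b => (weightedGram a 1 n x β b)⁻¹ := by
    simp_rw [Matrix.inv_def, Ring.inverse_eq_inv']
    exact (hM.matrix_det.inv₀ fun b => (hpd b).det_pos.ne').smul hM.matrix_adjugate
  unfold influence
  exact (PiLp.continuous_toLp 2 _).comp (hinv.matrix_mulVec continuous_const)

/-- One scoring step from the true parameters of a cluster: `(Xᵀ W X)⁻¹ Xᵀ (y - μ)`. -/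
def scoringStep (a : ℝ → ℝ) (n : ℕ) (x : ℕ → Vec p) (β b : Vec p) (y : ℕ → ℝ) : Vec p :=
  ∑ j : Fin n, (y j - deriv a (linPred (x j) β b)) • influence a n x β b j

/-- The squared length of a scoring step in the information metric. -/
def scoreEnergy (a : ℝ → ℝ) (n : ℕ) (x : ℕ → Vec p) (β b : Vec p) (y : ℕ → ℝ) : ℝ :=
  ∑ l : Fin n, iteratedDeriv 2 a (linPred (x l) β b) *
    inner ℝ (x l) (scoringStep a n x β b y) ^ 2

/-- The linearized score equation `XᵀWX t = Xᵀ(y - μ)`, tested against `v`. -/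
lemma sum_weight_inner_scoringStep (hpd : (weightedGram a 1 n x β b).PosDef) (y : ℕ → ℝ)
    (v : Vec p) :
    ∑ l : Fin n, iteratedDeriv 2 a (linPred (x l) β b) *
      (inner ℝ (x l) v * inner ℝ (x l) (scoringStep a n x β b y)) =
    ∑ j : Fin n, (y j - deriv a (linPred (x j) β b)) * inner ℝ (x j) v := by
  simp_rw [scoringStep, inner_sum, real_inner_smul_right, Finset.mul_sum]
  rw [Finset.sum_comm]
  refine Finset.sum_congr rfl fun j _ => ?_
  rw [← sum_weight_inner_influence hpd j v, Finset.mul_sum]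
  refine Finset.sum_congr rfl fun l _ => ?_
  ring

/-- Up to the factor `φ`, the left side is the conditional second moment of the scoring step. The
information form of the `j`-th influence vector is the inner product of `x_j` with that vector, so
the weighted sum reduces to the total leverage `p`. -/
lemma sum_weight_norm_sq_influence (h : DesignBound n x τ) (hτ : 0 ≤ τ) (hc₀ : 0 < c₀)
    (h0 : ∀ η, c₀ ≤ iteratedDeriv 2 a η) :
    ∑ j : Fin n, iteratedDeriv 2 a (linPred (x j) β b) * ‖influence a n x β b j‖ ^ 2 ≤
      τ * c₀⁻¹ * p := by
  have hpd : (weightedGram a 1 n x β b).PosDef := h.posDef_weightedGram hτ hc₀ h0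
  rw [← sum_leverage hpd, Finset.mul_sum]
  refine Finset.sum_le_sum fun j _ => ?_
  rw [mul_left_comm]
  refine mul_le_mul_of_nonneg_left ?_ (hc₀.le.trans (h0 _))
  refine (h.le_weighted hτ hc₀ (fun j => iteratedDeriv 2 a (linPred (x j) β b))
    (fun j => h0 _) _).trans (le_of_eq ?_)
  rw [← sum_weight_inner_influence hpd j (influence a n x β b j)]
  simp_rw [sq]

/-- Up to the factor `φ`, this is the conditional mean of `scoreEnergy`. The hat matrix is a
projection, so its sum of squares is again the total leverage. -/
lemma sum_sum_sq_influence (hpd : (weightedGram a 1 n x β b).PosDef)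
    (h0 : ∀ η, 0 ≤ iteratedDeriv 2 a η) :
    ∑ l : Fin n, ∑ j : Fin n, (√(iteratedDeriv 2 a (linPred (x l) β b)) *
      inner ℝ (x l) (influence a n x β b j)) ^ 2 * iteratedDeriv 2 a (linPred (x j) β b) = p := by
  rw [Finset.sum_comm, ← sum_leverage hpd]
  refine Finset.sum_congr rfl fun j _ => ?_
  rw [← sum_weight_inner_influence hpd j (influence a n x β b j), Finset.mul_sum]
  refine Finset.sum_congr rfl fun l _ => ?_
  rw [mul_pow, Real.sq_sqrt (h0 _)]
  ring

end Step

/-! ### Moments of the scoring steps -/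

section Moments

variable {p : ℕ} {Ω : Type*} [MeasurableSpace Ω] {μ : Measure Ω}
  {ν : Measure ℝ} [SigmaFinite ν] {a : ℝ → ℝ} {c : ℝ → ℝ → ℝ} {φ c₀ : ℝ} {β : Vec p}
  {G : Matrix (Fin p) (Fin p) ℝ} {m : ℕ} {n : ℕ → ℕ} {x : ℕ → ℕ → Vec p}
  {b : ℕ → Ω → Vec p} {y : ℕ → ℕ → Ω → ℝ} {τ : ℕ → ℝ}

/-- The expected energy of a scoring step is at most `φ p`. -/
lemma HasGLMMLaw.lintegral_scoreEnergy_le (h : HasGLMMLaw μ ν a c φ β G m n x b y)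
    (hfam : IsExpFamily ν a c φ) (hφ : 0 < φ) (ha : ContDiff ℝ 3 a) (hc₀ : 0 < c₀)
    (h0 : ∀ η, c₀ ≤ iteratedDeriv 2 a η) (i : Fin m) (hτ : 0 ≤ τ i)
    (hd : DesignBound (n i) (x i) (τ i)) :
    ∫⁻ ω, ENNReal.ofReal (scoreEnergy a (n i) (x i) β (b i ω) (fun j => y i j ω)) ∂μ ≤
      ENNReal.ofReal (φ * p) := by
  have h0' : ∀ η, 0 ≤ iteratedDeriv 2 a η := fun η => hc₀.le.trans (h0 η)
  have hpd : ∀ b, (weightedGram a 1 (n i) (x i) β b).PosDef := fun b =>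
    hd.posDef_weightedGram hτ hc₀ h0
  have hca := ha.continuous_iteratedDeriv 2 (by norm_num)
  -- The energy is the sum over `l` of squares of `√w_l ⟨x_l, t⟩`, each linear in the centered
  -- responses; the coefficients vanish outside cluster `i`.
  refine le_trans (le_of_eq ?_) (h.lintegral_sum_sq_le hfam hφ ha (κ := Fin (n i))
    (fun l q B => if q.1 = i then √(iteratedDeriv 2 a (linPred (x i l) β (B i))) *
      inner ℝ (x i l) (influence a (n i) (x i) β (B i) q.2) else 0) ?_ p ?_)
  · refine lintegral_congr fun ω => ?_
    congr 1
    refine Finset.sum_congr rfl fun l _ => ?_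
    simp only [ite_mul, zero_mul]
    rw [Fintype.sum_sigma, Finset.sum_eq_single i]
    · simp only [if_true, scoringStep, inner_sum, real_inner_smul_right]
      simp_rw [mul_assoc]
      rw [← Finset.mul_sum, mul_pow, Real.sq_sqrt (h0' _)]
      congr 2
      exact Finset.sum_congr rfl fun j _ => mul_comm _ _
    · intro i' _ hi'
      simp [hi']
    · simp
  · intro l q
    by_cases hq : q.1 = i
    · simp only [hq, if_true]
      refine Measurable.mul ?_ ?_
      · exact ((Real.continuous_sqrt.comp (hca.comp (continuous_linPred _ _))).comp
          (continuous_apply i)).measurable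
      · refine Continuous.measurable ?_
        exact ((continuous_const.inner (continuous_influence ha hpd q.2)).comp (continuous_apply i))
    · simp only [hq, if_false]
      exact measurable_const
  · intro B
    rw [← sum_sum_sq_influence (hpd (B i)) h0']
    refine le_of_eq (Finset.sum_congr rfl fun l _ => ?_)
    rw [Fintype.sum_sigma, Finset.sum_eq_single i]
    · simp
    · intro i' _ hi'
      simp [hi']
    · simp

/-- The scoring steps of the clusters are uncorrelated given the random effects. -/
lemma HasGLMMLaw.lintegral_norm_sq_sum_scoringStep_le (h : HasGLMMLaw μ ν a c φ β G m n x b y)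
    (hfam : IsExpFamily ν a c φ) (hφ : 0 < φ) (ha : ContDiff ℝ 3 a) (hc₀ : 0 < c₀)
    (h0 : ∀ η, c₀ ≤ iteratedDeriv 2 a η) (hτ : ∀ i, 0 ≤ τ i)
    (hd : ∀ i : Fin m, DesignBound (n i) (x i) (τ i)) :
    ∫⁻ ω, ENNReal.ofReal
      (‖∑ i : Fin m, scoringStep a (n i) (x i) β (b i ω) (fun j => y i j ω)‖ ^ 2) ∂μ ≤
      ENNReal.ofReal (φ * (c₀⁻¹ * p * ∑ i : Fin m, τ i)) := by
  have hpd : ∀ (i : Fin m) b, (weightedGram a 1 (n i) (x i) β b).PosDef := fun i b =>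
    (hd i).posDef_weightedGram (hτ i) hc₀ h0
  -- Each coordinate of the total step is one linear form in all centered responses, so clusters
  -- contribute additively.
  refine le_trans (le_of_eq ?_) (h.lintegral_sum_sq_le hfam hφ ha (κ := Fin p)
    (fun r q B => influence a (n q.1) (x q.1) β (B q.1) q.2 r) ?_
    (c₀⁻¹ * p * ∑ i : Fin m, τ i) ?_)
  · refine lintegral_congr fun ω => ?_
    congr 1
    rw [EuclideanSpace.real_norm_sq_eq]
    refine Finset.sum_congr rfl fun r _ => ?_
    congr 1
    rw [Fintype.sum_sigma]
    simp only [scoringStep, WithLp.ofLp_sum, Finset.sum_apply, WithLp.ofLp_smul, Pi.smul_apply,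
      smul_eq_mul]
    exact Finset.sum_congr rfl fun i _ => Finset.sum_congr rfl fun j _ => mul_comm _ _
  · intro r q
    refine Continuous.measurable ?_
    have h1 := (continuous_influence ha (hpd q.1) q.2).comp
      (continuous_apply (A := fun _ : Fin m => Vec p) q.1)
    exact (by fun_prop : Continuous fun v : Vec p => v r).comp h1
  · intro B
    rw [Finset.sum_comm, Fintype.sum_sigma, Finset.mul_sum]
    refine Finset.sum_le_sum fun i _ => ?_
    refine le_trans (le_of_eq ?_)
      ((sum_weight_norm_sq_influence (b := B i) (β := β) (hd i) (hτ i) hc₀ h0).trans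
        (le_of_eq (by ring)))
    refine Finset.sum_congr rfl fun j _ => ?_
    rw [EuclideanSpace.real_norm_sq_eq, Finset.mul_sum]
    exact Finset.sum_congr rfl fun r _ => mul_comm _ _

end Moments

/-! ### Score equations of the estimator -/

section Score

variable {p : ℕ} {a : ℝ → ℝ} {c : ℝ → ℝ → ℝ} {φ : ℝ} {G : Matrix (Fin p) (Fin p) ℝ} {m : ℕ}
  {n : ℕ → ℕ} {x : ℕ → ℕ → Vec p} {y : ℕ → ℕ → ℝ} {βhat : Vec p} {bhat : Fin m → Vec p}

lemma linPred_add_smul (z β b v u : Vec p) (t : ℝ) :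
    linPred z (β + t • v) (b + t • u) =
      linPred z β b + t * (inner ℝ z v + inner ℝ z u) := by
  unfold linPred
  simp only [inner_add_right, real_inner_smul_right]
  ring

/-- Stationarity of the PQL objective function in the direction `(v, u)`. -/
lemma IsPQLEstimate.stationary (h : IsPQLEstimate a c φ G m n x y βhat bhat)
    (ha : ContDiff ℝ 3 a) (hG : G.PosDef) (v : Vec p) (u : Fin m → Vec p) :
    ∑ i : Fin m, ∑ j : Fin (n i), φ⁻¹ * ((y i j - deriv a (linPred (x i j) βhat (bhat i))) *
      (inner ℝ (x i j) v + inner ℝ (x i j) (u i))) -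
    ∑ i : Fin m, (u i).ofLp ⬝ᵥ (G⁻¹ *ᵥ (bhat i).ofLp) = 0 := by
  set g : ℝ → ℝ := fun t => objective a c φ G m n x y (βhat + t • v) (fun i => bhat i + t • u i)
    with hg
  have hmax : IsLocalMax g 0 := by
    refine Filter.Eventually.of_forall fun t => ?_
    simpa [hg] using h (βhat + t • v) (fun i => bhat i + t • u i)
  have hquad : ∀ (i : Fin m) (t : ℝ),
      (bhat i + t • u i).ofLp ⬝ᵥ (G⁻¹ *ᵥ (bhat i + t • u i).ofLp) =
      (bhat i).ofLp ⬝ᵥ (G⁻¹ *ᵥ (bhat i).ofLp) + t * (2 * ((u i).ofLp ⬝ᵥ (G⁻¹ *ᵥ (bhat i).ofLp))) +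
        t ^ 2 * ((u i).ofLp ⬝ᵥ (G⁻¹ *ᵥ (u i).ofLp)) := by
    intro i t
    have hs := dotProduct_mulVec_comm hG.inv.isHermitian (bhat i).ofLp (u i).ofLp
    simp only [WithLp.ofLp_add, WithLp.ofLp_smul, Matrix.mulVec_add, Matrix.mulVec_smul,
      dotProduct_add, add_dotProduct, smul_dotProduct, dotProduct_smul, smul_eq_mul, hs]
    ring
  have hderiv : HasDerivAt g (∑ i : Fin m, ∑ j : Fin (n i), φ⁻¹ *
      ((y i j - deriv a (linPred (x i j) βhat (bhat i))) *
      (inner ℝ (x i j) v + inner ℝ (x i j) (u i))) -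
      1 / 2 * ∑ i : Fin m, 2 * ((u i).ofLp ⬝ᵥ (G⁻¹ *ᵥ (bhat i).ofLp))) 0 := by
    simp only [hg, objective, linPred_add_smul, hquad]
    refine HasDerivAt.sub ?_ (HasDerivAt.const_mul _ ?_)
    · refine HasDerivAt.fun_sum fun i _ => HasDerivAt.fun_sum fun j _ => ?_
      unfold logDensity
      refine HasDerivAt.add_const _ (HasDerivAt.const_mul _ ?_)
      set D := inner ℝ (x i j) v + inner ℝ (x i j) (u i)
      set η := linPred (x i j) βhat (bhat i)
      have hl : HasDerivAt (fun t : ℝ => η + t * D) D 0 := by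
        simpa using ((hasDerivAt_id (0 : ℝ)).mul_const D).const_add η
      have hA := (hasDerivAt_of_contDiff_three ha (η + 0 * D)).comp (0 : ℝ) hl
      rw [zero_mul, add_zero] at hA
      have := (hl.const_mul (y i j)).sub hA
      rw [sub_mul]
      exact this
    · refine HasDerivAt.fun_sum fun i _ => ?_
      set A := (bhat i).ofLp ⬝ᵥ (G⁻¹ *ᵥ (bhat i).ofLp)
      set B := 2 * ((u i).ofLp ⬝ᵥ (G⁻¹ *ᵥ (bhat i).ofLp))
      set C := (u i).ofLp ⬝ᵥ (G⁻¹ *ᵥ (u i).ofLp)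
      have h1 := (((hasDerivAt_id (0 : ℝ)).mul_const B).const_add A).fun_add
        (((hasDerivAt_id (0 : ℝ)).pow 2).mul_const C)
      simpa using h1
  have := hmax.hasDerivAt_eq_zero hderiv
  rw [← Finset.mul_sum, ← mul_assoc] at this
  simpa using this

/-- Only `b_i` is varied. Multiplying by `φ` puts the working quantities entirely into the penalty
matrix `φ G⁻¹`. -/
lemma IsPQLEstimate.score_eq (h : IsPQLEstimate a c φ G m n x y βhat bhat)
    (ha : ContDiff ℝ 3 a) (hφ : 0 < φ) (hG : G.PosDef) (i : Fin m) (v : Vec p) :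
    ∑ j : Fin (n i), (y i j - deriv a (linPred (x i j) βhat (bhat i))) * inner ℝ (x i j) v =
      v.ofLp ⬝ᵥ ((φ • G⁻¹) *ᵥ (bhat i).ofLp) := by
  have := h.stationary ha hG 0 (Pi.single i v)
  rw [Finset.sum_eq_single i, Finset.sum_eq_single i] at this
  · simp only [Pi.single_eq_same, inner_zero_right, zero_add] at this
    rw [← Finset.mul_sum] at this
    rw [Matrix.smul_mulVec, dotProduct_smul, smul_eq_mul, ← sub_eq_zero.1 this,
      mul_inv_cancel_left₀ hφ.ne']
  · intro i' _ hi'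
    simp [Pi.single_eq_of_ne hi']
  · simp
  · intro i' _ hi'
    simp [Pi.single_eq_of_ne hi']
  · simp

/-- The estimated random effects sum to zero, since each covariate carries a fixed effect too. -/
lemma IsPQLEstimate.sum_eq_zero (h : IsPQLEstimate a c φ G m n x y βhat bhat)
    (ha : ContDiff ℝ 3 a) (hG : G.PosDef) : ∑ i, bhat i = 0 := by
  have hv : ∀ v : Vec p, v.ofLp ⬝ᵥ (G⁻¹ *ᵥ (∑ i, bhat i).ofLp) = 0 := by
    intro v
    -- Along this direction no linear predictor changes, so only the penalty contributes to the
    -- derivative.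
    have := h.stationary ha hG v (fun _ => -v)
    simp only [inner_neg_right, add_neg_cancel, mul_zero, Finset.sum_const_zero, zero_sub,
      WithLp.ofLp_neg, neg_dotProduct, Finset.sum_neg_distrib, neg_neg] at this
    rw [WithLp.ofLp_sum, Matrix.mulVec_sum, dotProduct_sum]
    exact this
  by_contra hne
  have hne' : (∑ i, bhat i).ofLp ≠ 0 := fun h0 => hne (by
    have := congrArg (WithLp.toLp 2) h0
    simpa using this)
  have := hG.inv.dotProduct_mulVec_pos hne'
  rw [star_trivial, hv] at this
  exact lt_irrefl _ this

end Score

/-! ### Bounds for the cumulant function -/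

section Cumulant

variable {a : ℝ → ℝ} {c₀ : ℝ}

/-- Strong monotonicity of `a'`: the function `a'(t) - c₀ t` is increasing. -/
lemma deriv_sub_mul_ge (ha : ContDiff ℝ 3 a) (h0 : ∀ η, c₀ ≤ iteratedDeriv 2 a η) (η h : ℝ) :
    c₀ * h ^ 2 ≤ (deriv a (η + h) - deriv a η) * h := by
  have hmono : Monotone fun t => deriv a t - c₀ * t := by
    refine monotone_of_hasDerivAt_nonneg (f' := fun t => iteratedDeriv 2 a t - c₀)
      (fun t => ?_) (fun t => sub_nonneg.2 (h0 t))
    simpa using (hasDerivAt_deriv_of_contDiff_three ha t).fun_sub ((hasDerivAt_id t).const_mul c₀)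
  rcases le_total 0 h with hh | hh
  · have := hmono (le_add_of_nonneg_right hh : η ≤ η + h)
    simp only at this
    nlinarith
  · have := hmono (add_le_of_nonpos_right hh : η + h ≤ η)
    simp only at this
    nlinarith

/-- The mean value inequality is used twice: `a''` is Lipschitz, so `a'(t) - a''(η) t` has
derivative at most `c₀⁻¹ |h|` between `η` and `η + h`. The factor `1/2` of Taylor's formula is given
away. -/
lemma abs_deriv_sub_linear_le (ha : ContDiff ℝ 3 a) (hc₀ : 0 < c₀)
    (h3 : ∀ η, |iteratedDeriv 3 a η| ≤ c₀⁻¹) (η h : ℝ) :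
    |deriv a (η + h) - deriv a η - iteratedDeriv 2 a η * h| ≤ c₀⁻¹ * h ^ 2 := by
  have hd3 : ∀ t, HasDerivAt (iteratedDeriv 2 a) (iteratedDeriv 3 a t) t := by
    intro t
    have hd : Differentiable ℝ (iteratedDeriv 2 a) :=
      ha.differentiable_iteratedDeriv 2 (by norm_num)
    have := (hd t).hasDerivAt
    rwa [← iteratedDeriv_succ] at this
  have hlip : ∀ s t, |iteratedDeriv 2 a t - iteratedDeriv 2 a s| ≤ c₀⁻¹ * |t - s| := by
    intro s t
    have := convex_univ.norm_image_sub_le_of_norm_hasDerivWithin_le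
      (f := iteratedDeriv 2 a) (f' := iteratedDeriv 3 a) (C := c₀⁻¹)
      (fun z _ => (hd3 z).hasDerivWithinAt) (fun z _ => by simpa using h3 z)
      (Set.mem_univ s) (Set.mem_univ t)
    simpa using this
  have hseg := (convex_uIcc η (η + h)).norm_image_sub_le_of_norm_hasDerivWithin_le
    (f := fun t => deriv a t - iteratedDeriv 2 a η * t)
    (f' := fun t => iteratedDeriv 2 a t - iteratedDeriv 2 a η) (C := c₀⁻¹ * |h|)
    (fun z _ => by
      have := (hasDerivAt_deriv_of_contDiff_three ha z).fun_sub
        ((hasDerivAt_id z).const_mul (iteratedDeriv 2 a η))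
      simpa using this.hasDerivWithinAt)
    (fun z hz => by
      refine (hlip η z).trans (mul_le_mul_of_nonneg_left ?_ (inv_nonneg.2 hc₀.le))
      have := Set.abs_sub_left_of_mem_uIcc hz
      simpa using this)
    Set.left_mem_uIcc Set.right_mem_uIcc
  rw [Real.norm_eq_abs, Real.norm_eq_abs] at hseg
  have e1 : deriv a (η + h) - iteratedDeriv 2 a η * (η + h) -
      (deriv a η - iteratedDeriv 2 a η * η) =
      deriv a (η + h) - deriv a η - iteratedDeriv 2 a η * h := by ring
  rw [e1, add_sub_cancel_left, mul_assoc, abs_mul_abs_self, ← sq] at hseg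
  exact hseg

end Cumulant

/-! ### The estimation error of a cluster -/

section Cluster

variable {p : ℕ} {a : ℝ → ℝ} {c₀ τ B L : ℝ} {n : ℕ} {x : ℕ → Vec p} {β b δ bh u : Vec p}
  {y : ℕ → ℝ} {W : Matrix (Fin p) (Fin p) ℝ}

/-- Energy inequality for the error `δ` of the cluster parameter. -/
lemma energy_le (ha : ContDiff ℝ 3 a) (hc₀ : 0 < c₀) (h0 : ∀ η, c₀ ≤ iteratedDeriv 2 a η)
    (h1 : ∀ η, iteratedDeriv 2 a η ≤ c₀⁻¹) (hpd : (weightedGram a 1 n x β b).PosDef)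
    (hscore : ∀ v : Vec p, ∑ j : Fin n,
      (y j - deriv a (linPred (x j) β b + inner ℝ (x j) δ)) * inner ℝ (x j) v =
        v.ofLp ⬝ᵥ W *ᵥ bh.ofLp) :
    c₀ * ∑ j : Fin n, inner ℝ (x j) δ ^ 2 + 2 * (δ.ofLp ⬝ᵥ W *ᵥ bh.ofLp) ≤
      c₀⁻¹ ^ 2 * scoreEnergy a n x β b y := by
  have hs := sum_weight_inner_scoringStep hpd y δ
  rw [← hscore δ, scoreEnergy]
  set t := scoringStep a n x β b y with ht
  have hdiff : ∑ j : Fin n,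
      (y j - deriv a (linPred (x j) β b + inner ℝ (x j) δ)) * inner ℝ (x j) δ =
      ∑ l : Fin n, iteratedDeriv 2 a (linPred (x l) β b) *
        (inner ℝ (x l) δ * inner ℝ (x l) t) -
      ∑ j : Fin n, (deriv a (linPred (x j) β b + inner ℝ (x j) δ) -
        deriv a (linPred (x j) β b)) * inner ℝ (x j) δ := by
    rw [hs, ← Finset.sum_sub_distrib]
    exact Finset.sum_congr rfl fun j _ => by ring
  rw [hdiff, mul_sub, Finset.mul_sum, Finset.mul_sum, Finset.mul_sum, Finset.mul_sum,
    ← Finset.sum_sub_distrib, ← Finset.sum_add_distrib]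
  refine Finset.sum_le_sum fun j _ => ?_
  set w := iteratedDeriv 2 a (linPred (x j) β b)
  set g := inner ℝ (x j) t
  set h := inner ℝ (x j) δ
  have hconv := deriv_sub_mul_ge ha h0 (linPred (x j) β b) h
  have hw0 : 0 ≤ w := hc₀.le.trans (h0 _)
  have hw1 : c₀ ^ 2 * w ≤ c₀ := by
    have := mul_le_mul_of_nonneg_left (h1 (linPred (x j) β b)) (sq_nonneg c₀)
    rwa [sq, mul_assoc c₀ c₀ c₀⁻¹, mul_inv_cancel₀ hc₀.ne', mul_one, ← sq] at this
  -- The weights are chosen so that `c₀² w h² ≤ c₀ h²`; this uses up half of the `2 c₀ h²` supplied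
  -- by strong monotonicity.
  have hamgm : 2 * (w * (h * g)) ≤ c₀ ^ 2 * w * h ^ 2 + c₀⁻¹ ^ 2 * (w * g ^ 2) := by
    have := mul_nonneg hw0 (sq_nonneg (c₀ * h - c₀⁻¹ * g))
    have e : c₀ * c₀⁻¹ = 1 := mul_inv_cancel₀ hc₀.ne'
    have e2 : w * (c₀ * h - c₀⁻¹ * g) ^ 2 =
        c₀ ^ 2 * w * h ^ 2 + c₀⁻¹ ^ 2 * (w * g ^ 2) - 2 * (w * (h * g)) * (c₀ * c₀⁻¹) := by ring
    rw [e2, e] at this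
    linarith
  have := mul_le_mul_of_nonneg_right hw1 (sq_nonneg h)
  linarith

/-- The error of a cluster parameter agrees with the scoring step up to a term of second order. -/
lemma norm_sub_scoringStep_le (ha : ContDiff ℝ 3 a) (hc₀ : 0 < c₀)
    (h0 : ∀ η, c₀ ≤ iteratedDeriv 2 a η) (h3 : ∀ η, |iteratedDeriv 3 a η| ≤ c₀⁻¹)
    (hτ : 0 ≤ τ) (hd : DesignBound n x τ) (hB : ∀ j < n, ‖x j‖ ≤ B)
    (hscore : ∀ v : Vec p, ∑ j : Fin n,
      (y j - deriv a (linPred (x j) β b + inner ℝ (x j) δ)) * inner ℝ (x j) v =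
        v.ofLp ⬝ᵥ W *ᵥ bh.ofLp) :
    ‖δ - scoringStep a n x β b y‖ ≤ τ * c₀⁻¹ *
      (‖(WithLp.toLp 2 (W *ᵥ bh.ofLp) : Vec p)‖ +
        B * (c₀⁻¹ * ∑ j : Fin n, inner ℝ (x j) δ ^ 2)) := by
  have hpd : (weightedGram a 1 n x β b).PosDef := hd.posDef_weightedGram hτ hc₀ h0
  set t := scoringStep a n x β b y with ht
  set g := δ - t with hg
  set R := ‖(WithLp.toLp 2 (W *ᵥ bh.ofLp) : Vec p)‖ +
        B * (c₀⁻¹ * ∑ j : Fin n, inner ℝ (x j) δ ^ 2) with hR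
  have hs := sum_weight_inner_scoringStep hpd y g
  have hsc := hscore g
  have hWg : g.ofLp ⬝ᵥ W *ᵥ bh.ofLp = inner ℝ g (WithLp.toLp 2 (W *ᵥ bh.ofLp) : Vec p) := by
    rw [inner_eq_dotProduct]
  -- Testing the exact and the linearized score equations against the same `g` and subtracting
  -- cancels the responses; only the Taylor remainder and the penalty are left.
  have hkey : ∑ j : Fin n, iteratedDeriv 2 a (linPred (x j) β b) * inner ℝ (x j) g ^ 2 ≤
      ‖g‖ * R := by
    have hrem : -∑ j : Fin n, (deriv a (linPred (x j) β b + inner ℝ (x j) δ) -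
        deriv a (linPred (x j) β b) - iteratedDeriv 2 a (linPred (x j) β b) * inner ℝ (x j) δ) *
        inner ℝ (x j) g ≤ ‖g‖ * (B * (c₀⁻¹ * ∑ j : Fin n, inner ℝ (x j) δ ^ 2)) := by
      rw [← Finset.sum_neg_distrib, Finset.mul_sum, Finset.mul_sum, Finset.mul_sum]
      refine Finset.sum_le_sum fun j _ => (neg_le_abs _).trans ?_
      rw [abs_mul]
      have e1 := abs_deriv_sub_linear_le ha hc₀ h3 (linPred (x j) β b) (inner ℝ (x j) δ)
      have e2 : |inner ℝ (x j) g| ≤ B * ‖g‖ :=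
        (abs_real_inner_le_norm _ _).trans
          (mul_le_mul_of_nonneg_right (hB j j.2) (norm_nonneg _))
      calc _ ≤ (c₀⁻¹ * inner ℝ (x j) δ ^ 2) * (B * ‖g‖) :=
            mul_le_mul e1 e2 (abs_nonneg _)
              (mul_nonneg (inv_nonneg.2 hc₀.le) (sq_nonneg _))
        _ = _ := by ring
    have hpen : -(g.ofLp ⬝ᵥ W *ᵥ bh.ofLp) ≤
        ‖g‖ * ‖(WithLp.toLp 2 (W *ᵥ bh.ofLp) : Vec p)‖ := by
      rw [hWg]
      exact (neg_le_abs _).trans (abs_real_inner_le_norm _ _)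
    have hid : ∑ j : Fin n, iteratedDeriv 2 a (linPred (x j) β b) * inner ℝ (x j) g ^ 2 =
        -∑ j : Fin n, (deriv a (linPred (x j) β b + inner ℝ (x j) δ) -
        deriv a (linPred (x j) β b) - iteratedDeriv 2 a (linPred (x j) β b) * inner ℝ (x j) δ) *
        inner ℝ (x j) g - g.ofLp ⬝ᵥ W *ᵥ bh.ofLp := by
      rw [← hsc, ← Finset.sum_neg_distrib, ← Finset.sum_sub_distrib]
      have hsplit : ∀ j : Fin n, iteratedDeriv 2 a (linPred (x j) β b) * inner ℝ (x j) g ^ 2 =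
          iteratedDeriv 2 a (linPred (x j) β b) * (inner ℝ (x j) δ * inner ℝ (x j) g) -
          iteratedDeriv 2 a (linPred (x j) β b) * (inner ℝ (x j) g * inner ℝ (x j) t) := by
        intro j
        have : inner ℝ (x j) g = inner ℝ (x j) δ - inner ℝ (x j) t := by
          rw [hg, inner_sub_right]
        rw [this]
        ring
      rw [Finset.sum_congr rfl fun j _ => hsplit j, Finset.sum_sub_distrib, hs,
        ← Finset.sum_sub_distrib]
      exact Finset.sum_congr rfl fun j _ => by ring
    rw [hid, hR, mul_add]
    linarith
  have hlow := hd.le_weighted hτ hc₀ (fun j => iteratedDeriv 2 a (linPred (x j) β b))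
    (fun j => h0 _) g
  have hτc : 0 ≤ τ * c₀⁻¹ := mul_nonneg hτ (inv_nonneg.2 hc₀.le)
  have hfin : ‖g‖ * ‖g‖ ≤ τ * c₀⁻¹ * R * ‖g‖ := by
    calc ‖g‖ * ‖g‖ = ‖g‖ ^ 2 := (sq _).symm
      _ ≤ τ * c₀⁻¹ * (‖g‖ * R) := hlow.trans (mul_le_mul_of_nonneg_left hkey hτc)
      _ = _ := by ring
  -- Division by `‖g‖` requires `g ≠ 0`. Otherwise the right side must be nonnegative, which follows
  -- from `0 ≤ ‖x_0‖ ≤ B`, or from the empty sum when `n = 0`.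
  rcases (norm_nonneg g).eq_or_lt with hg0 | hg0
  · rw [← hg0] at hkey ⊢
    have hBq : 0 ≤ B * (c₀⁻¹ * ∑ j : Fin n, inner ℝ (x j) δ ^ 2) := by
      rcases Nat.eq_zero_or_pos n with hn | hn
      · subst hn
        simp
      · exact mul_nonneg ((norm_nonneg _).trans (hB 0 hn)) (mul_nonneg (inv_nonneg.2 hc₀.le)
          (Finset.sum_nonneg fun j _ => sq_nonneg _))
    exact mul_nonneg hτc (add_nonneg (norm_nonneg _) hBq)
  · exact le_of_mul_le_mul_right hfin hg0

/-- Cauchy-Schwarz for `W` gives `‖Wv‖² ≤ L · vᵀWv`, and the arithmetic-geometric mean inequality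
finishes. The penalty gradient is thereby bounded through the penalty value, which the energy
inequality controls. -/
lemma norm_mulVec_le (hW : W.PosSemidef) (hL : 0 ≤ L)
    (hWL : ∀ v : Vec p, v.ofLp ⬝ᵥ W *ᵥ v.ofLp ≤ L * ‖v‖ ^ 2) (v : Vec p) :
    ‖(WithLp.toLp 2 (W *ᵥ v.ofLp) : Vec p)‖ ≤ (L + v.ofLp ⬝ᵥ W *ᵥ v.ofLp) / 2 := by
  set g : Vec p := WithLp.toLp 2 (W *ᵥ v.ofLp) with hg
  have hq : 0 ≤ v.ofLp ⬝ᵥ W *ᵥ v.ofLp := by simpa using hW.dotProduct_mulVec_nonneg v.ofLp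
  have hgg : g.ofLp ⬝ᵥ W *ᵥ v.ofLp = ‖g‖ ^ 2 := by
    rw [← real_inner_self_eq_norm_sq, inner_eq_dotProduct]
  have hcs := sq_dotProduct_mulVec_le hW g.ofLp v.ofLp
  rw [hgg] at hcs
  have h1 : ‖g‖ ^ 2 * ‖g‖ ^ 2 ≤ L * (v.ofLp ⬝ᵥ W *ᵥ v.ofLp) * ‖g‖ ^ 2 := by
    calc ‖g‖ ^ 2 * ‖g‖ ^ 2 = (‖g‖ ^ 2) ^ 2 := (sq _).symm
      _ ≤ (L * ‖g‖ ^ 2) * (v.ofLp ⬝ᵥ W *ᵥ v.ofLp) :=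
        hcs.trans (mul_le_mul_of_nonneg_right (hWL g) hq)
      _ = _ := by ring
  have h2 : ‖g‖ ^ 2 ≤ L * (v.ofLp ⬝ᵥ W *ᵥ v.ofLp) := by
    rcases (sq_nonneg ‖g‖).eq_or_lt with h | h
    · rw [← h]
      exact mul_nonneg hL hq
    · exact le_of_mul_le_mul_right h1 h
  refine abs_le_of_sq_le_sq' (h2.trans ?_) (by positivity) |>.2
  nlinarith [sq_nonneg (L - v.ofLp ⬝ᵥ W *ᵥ v.ofLp)]

/-- Convexity of the penalty: expand `(v - u)ᵀW(v - u) ≥ 0`. -/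
lemma two_dotProduct_sub_ge (hW : W.PosSemidef) (u v : Vec p) :
    v.ofLp ⬝ᵥ W *ᵥ v.ofLp - u.ofLp ⬝ᵥ W *ᵥ u.ofLp ≤ 2 * ((v - u).ofLp ⬝ᵥ W *ᵥ v.ofLp) := by
  have h := hW.dotProduct_mulVec_nonneg (v - u).ofLp
  have hs := dotProduct_mulVec_comm hW.isHermitian v.ofLp u.ofLp
  simp only [star_trivial, WithLp.ofLp_sub, Matrix.mulVec_sub, sub_dotProduct,
    dotProduct_sub] at h ⊢
  linarith

/-- The error of a cluster parameter in terms of the scoring step, for penalty matrix `W` bounded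
by `L`. -/
lemma norm_sub_scoringStep_le_energy (ha : ContDiff ℝ 3 a) (hc₀ : 0 < c₀)
    (h0 : ∀ η, c₀ ≤ iteratedDeriv 2 a η) (h1 : ∀ η, iteratedDeriv 2 a η ≤ c₀⁻¹)
    (h3 : ∀ η, |iteratedDeriv 3 a η| ≤ c₀⁻¹)
    (hτ : 0 ≤ τ) (hd : DesignBound n x τ) (hB0 : 0 ≤ B) (hB : ∀ j < n, ‖x j‖ ≤ B)
    (hW : W.PosSemidef) (hL : 0 ≤ L) (hWL : ∀ v : Vec p, v.ofLp ⬝ᵥ W *ᵥ v.ofLp ≤ L * ‖v‖ ^ 2)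
    (hscore : ∀ v : Vec p, ∑ j : Fin n,
      (y j - deriv a (linPred (x j) β b + inner ℝ (x j) δ)) * inner ℝ (x j) v =
        v.ofLp ⬝ᵥ W *ᵥ bh.ofLp) (hδ : δ = bh - u) :
    ‖δ - scoringStep a n x β b y‖ ≤ τ * (c₀⁻¹ * (1 + B * c₀⁻¹ ^ 2)) *
      (L + c₀⁻¹ ^ 2 * scoreEnergy a n x β b y + L * ‖u‖ ^ 2) := by
  have hpd : (weightedGram a 1 n x β b).PosDef := hd.posDef_weightedGram hτ hc₀ h0
  have hen := energy_le ha hc₀ h0 h1 hpd hscore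
  have hpol := two_dotProduct_sub_ge hW u bh
  rw [← hδ] at hpol
  have hci : 0 < c₀⁻¹ := inv_pos.2 hc₀
  set q := ∑ j : Fin n, inner ℝ (x j) δ ^ 2 with hq
  have hq0 : 0 ≤ q := Finset.sum_nonneg fun j _ => sq_nonneg _
  set E := c₀⁻¹ ^ 2 * scoreEnergy a n x β b y + L * ‖u‖ ^ 2 with hE
  have hbh : 0 ≤ bh.ofLp ⬝ᵥ W *ᵥ bh.ofLp := by simpa using hW.dotProduct_mulVec_nonneg bh.ofLp
  -- The energy inequality and convexity of the penalty together bound the prediction error `q` and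
  -- the penalty of `bh` at once.
  have hsum : c₀ * q + bh.ofLp ⬝ᵥ W *ᵥ bh.ofLp ≤ E := by
    have := hWL u
    linarith
  have hqE : c₀⁻¹ * q ≤ c₀⁻¹ ^ 2 * E := by
    have : q ≤ c₀⁻¹ * E := by
      rw [inv_mul_eq_div, le_div_iff₀ hc₀]
      linarith
    calc c₀⁻¹ * q ≤ c₀⁻¹ * (c₀⁻¹ * E) := mul_le_mul_of_nonneg_left this hci.le
      _ = _ := by ring
  have hE0 : 0 ≤ E := by
    have := mul_nonneg hc₀.le hq0
    linarith
  refine (norm_sub_scoringStep_le ha hc₀ h0 h3 hτ hd hB hscore).trans ?_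
  have hn := norm_mulVec_le hW hL hWL bh
  rw [add_assoc, ← hE]
  calc _ ≤ τ * c₀⁻¹ * ((L + E) + B * (c₀⁻¹ ^ 2 * (L + E))) := by
        refine mul_le_mul_of_nonneg_left (add_le_add ?_ ?_) (mul_nonneg hτ hci.le)
        · have := mul_nonneg hc₀.le hq0
          linarith
        · refine mul_le_mul_of_nonneg_left (hqE.trans ?_) hB0
          exact mul_le_mul_of_nonneg_left (by linarith) (sq_nonneg _)
    _ = _ := by ring

end Cluster

/-! ### The estimation error of the fixed effects -/

section Stage

variable {p : ℕ} {a : ℝ → ℝ} {c : ℝ → ℝ → ℝ} {c₀ B φ : ℝ} {G : Matrix (Fin p) (Fin p) ℝ}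
  {m : ℕ} {n : ℕ → ℕ} {x : ℕ → ℕ → Vec p} {y : ℕ → ℕ → ℝ} {β βhat : Vec p}
  {b : ℕ → Vec p} {bhat : Fin m → Vec p} {τ : ℕ → ℝ}

/-- A bound for the penalty matrix `φ G⁻¹`. -/
def penaltyBound (φ : ℝ) (G : Matrix (Fin p) (Fin p) ℝ) : ℝ := φ * ∑ r, ∑ s, |G⁻¹ r s|

lemma penaltyBound_nonneg (hφ : 0 < φ) : 0 ≤ penaltyBound φ G :=
  mul_nonneg hφ.le (Finset.sum_nonneg fun _ _ => Finset.sum_nonneg fun _ _ => abs_nonneg _)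

lemma dotProduct_penalty_le (hφ : 0 < φ) (v : Vec p) :
    v.ofLp ⬝ᵥ (φ • G⁻¹) *ᵥ v.ofLp ≤ penaltyBound φ G * ‖v‖ ^ 2 := by
  rw [Matrix.smul_mulVec, dotProduct_smul, smul_eq_mul, penaltyBound, mul_assoc]
  refine mul_le_mul_of_nonneg_left ?_ hφ.le
  rw [dotProduct, Finset.sum_mul]
  refine Finset.sum_le_sum fun r _ => ?_
  rw [Matrix.mulVec, dotProduct, Finset.mul_sum, Finset.sum_mul]
  refine Finset.sum_le_sum fun s _ => (le_abs_self _).trans ?_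
  rw [abs_mul, abs_mul, mul_left_comm]
  refine mul_le_mul_of_nonneg_left ?_ (abs_nonneg _)
  have hr : |v r| ≤ ‖v‖ := by simpa using PiLp.norm_apply_le v r
  have hs : |v s| ≤ ‖v‖ := by simpa using PiLp.norm_apply_le v s
  rw [sq]
  exact mul_le_mul hr hs (abs_nonneg _) (norm_nonneg _)

lemma scoreEnergy_nonneg {n : ℕ} {x : ℕ → Vec p} {β b : Vec p} {y : ℕ → ℝ}
    (h0 : ∀ η, 0 ≤ iteratedDeriv 2 a η) : 0 ≤ scoreEnergy a n x β b y :=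
  Finset.sum_nonneg fun _ _ => mul_nonneg (h0 _) (sq_nonneg _)

/-- The average energy of the scoring steps and the random effects. -/
def averageEnergy (a : ℝ → ℝ) (m : ℕ) (n : ℕ → ℕ) (x : ℕ → ℕ → Vec p) (β : Vec p)
    (b : ℕ → Vec p) (y : ℕ → ℕ → ℝ) : ℝ :=
  (m : ℝ)⁻¹ * ∑ i : Fin m, (scoreEnergy a (n i) (x i) β (b i) (y i) + ‖b i‖ ^ 2)

/-- The energies of the clusters weighted by the design bounds `τ i`. -/
def weightedEnergy (a : ℝ → ℝ) (m : ℕ) (n : ℕ → ℕ) (x : ℕ → ℕ → Vec p) (β : Vec p)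
    (b : ℕ → Vec p) (y : ℕ → ℕ → ℝ) (τ : ℕ → ℝ) : ℝ :=
  (√(m : ℝ))⁻¹ * ∑ i : Fin m, τ i * (1 + (scoreEnergy a (n i) (x i) β (b i) (y i) + ‖b i‖ ^ 2))

/-- The normalized sum of the scoring steps. -/
def normalizedStep (a : ℝ → ℝ) (m : ℕ) (n : ℕ → ℕ) (x : ℕ → ℕ → Vec p) (β : Vec p)
    (b : ℕ → Vec p) (y : ℕ → ℕ → ℝ) : ℝ :=
  (√(m : ℝ))⁻¹ * ‖∑ i : Fin m, scoringStep a (n i) (x i) β (b i) (y i)‖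

/-- The total error of cluster `i` is written as `bhat_i - u` with `u = b_i - (βhat - β)`, the form
in which convexity of the penalty applies. -/
lemma IsPQLEstimate.score_eq_error (h : IsPQLEstimate a c φ G m n x y βhat bhat)
    (ha : ContDiff ℝ 3 a) (hφ : 0 < φ) (hG : G.PosDef) (i : Fin m) (v : Vec p) :
    ∑ j : Fin (n i), (y i j - deriv a (linPred (x i j) β (b i) +
      inner ℝ (x i j) (bhat i - (b i - (βhat - β))))) * inner ℝ (x i j) v =
      v.ofLp ⬝ᵥ ((φ • G⁻¹) *ᵥ (bhat i).ofLp) := by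
  rw [← h.score_eq ha hφ hG i v]
  refine Finset.sum_congr rfl fun j _ => ?_
  congr 3
  unfold linPred
  simp only [inner_sub_right]
  ring

lemma posSemidef_penalty (hφ : 0 < φ) (hG : G.PosDef) : (φ • G⁻¹).PosSemidef :=
  hG.inv.posSemidef.smul hφ.le

/-- A priori bound for the error of the fixed effects. -/
lemma IsPQLEstimate.norm_sub_le (h : IsPQLEstimate a c φ G m n x y βhat bhat)
    (ha : ContDiff ℝ 3 a) (hc₀ : 0 < c₀) (h0 : ∀ η, c₀ ≤ iteratedDeriv 2 a η)
    (h1 : ∀ η, iteratedDeriv 2 a η ≤ c₀⁻¹) (hφ : 0 < φ) (hG : G.PosDef) (hm : 0 < m)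
    (hτ : ∀ i, 0 ≤ τ i) (hd : ∀ i : Fin m, DesignBound (n i) (x i) (τ i)) :
    ‖βhat - β‖ ≤ 1 + (m : ℝ)⁻¹ * ∑ i : Fin m, τ i +
      (1 + c₀⁻¹ ^ 3 + c₀⁻¹ * penaltyBound φ G) * averageEnergy a m n x β b y := by
  have hci : 0 < c₀⁻¹ := inv_pos.2 hc₀
  have hm0 : (0 : ℝ) < m := by exact_mod_cast hm
  set L := penaltyBound φ G
  have hL : 0 ≤ L := penaltyBound_nonneg hφ
  set W := φ • G⁻¹
  have hW : W.PosSemidef := posSemidef_penalty hφ hG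
  set Δ := βhat - β with hΔ
  set δ : Fin m → Vec p := fun i => bhat i - (b i - Δ) with hδ
  set E : Fin m → ℝ := fun i => scoreEnergy a (n i) (x i) β (b i) (y i) with hE
  set q : Fin m → ℝ := fun i => ∑ j : Fin (n i), inner ℝ (x i j) (δ i) ^ 2 with hq
  have hE0 : ∀ i, 0 ≤ E i := fun i => scoreEnergy_nonneg fun η => hc₀.le.trans (h0 η)
  have hq0 : ∀ i, 0 ≤ q i := fun i => Finset.sum_nonneg fun _ _ => sq_nonneg _
  have hsum0 := h.sum_eq_zero ha hG
  -- The cross terms between `Δ` and the penalty cancel after summation over clusters, so the energy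
  -- bound is free of `Δ` and the argument is not circular.
  have hpen : ∑ i, Δ.ofLp ⬝ᵥ W *ᵥ (bhat i).ofLp = 0 := by
    rw [← dotProduct_sum, ← Matrix.mulVec_sum, ← WithLp.ofLp_sum, hsum0]
    simp
  have hclus : ∀ i, c₀ * q i + 2 * (Δ.ofLp ⬝ᵥ W *ᵥ (bhat i).ofLp) ≤
      c₀⁻¹ ^ 2 * E i + L * ‖b i‖ ^ 2 := by
    intro i
    have hpd : (weightedGram a 1 (n i) (x i) β (b i)).PosDef :=
      (hd i).posDef_weightedGram (hτ i) hc₀ h0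
    have hen := energy_le ha hc₀ h0 h1 hpd (h.score_eq_error ha hφ hG i)
    have hpol := two_dotProduct_sub_ge hW (b i) (bhat i)
    have hbh : 0 ≤ (bhat i).ofLp ⬝ᵥ W *ᵥ (bhat i).ofLp := by
      simpa using hW.dotProduct_mulVec_nonneg (bhat i).ofLp
    have hb := dotProduct_penalty_le (G := G) hφ (b i)
    have hsplit : (δ i).ofLp ⬝ᵥ W *ᵥ (bhat i).ofLp =
        (bhat i - b i).ofLp ⬝ᵥ W *ᵥ (bhat i).ofLp + Δ.ofLp ⬝ᵥ W *ᵥ (bhat i).ofLp := by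
      rw [← add_dotProduct, ← WithLp.ofLp_add, hδ]
      congr 2
      exact (sub_add _ _ _).symm
    have hen' : c₀ * q i + 2 * ((δ i).ofLp ⬝ᵥ W *ᵥ (bhat i).ofLp) ≤ c₀⁻¹ ^ 2 * E i := hen
    linarith
  have htot : c₀ * ∑ i, q i ≤ ∑ i : Fin m, (c₀⁻¹ ^ 2 * E i + L * ‖b i‖ ^ 2) := by
    have := Finset.sum_le_sum fun i (_ : i ∈ Finset.univ) => hclus i
    rw [Finset.sum_add_distrib, ← Finset.mul_sum, ← Finset.mul_sum, hpen, mul_zero,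
      add_zero] at this
    exact this
  have hqtot : ∑ i, q i ≤ ∑ i : Fin m, (c₀⁻¹ ^ 3 + c₀⁻¹ * L) * (E i + ‖b i‖ ^ 2) := by
    have h2 : ∑ i, q i ≤ c₀⁻¹ * ∑ i : Fin m, (c₀⁻¹ ^ 2 * E i + L * ‖b i‖ ^ 2) := by
      rw [inv_mul_eq_div, le_div_iff₀ hc₀, mul_comm]
      exact htot
    refine h2.trans ?_
    rw [Finset.mul_sum]
    refine Finset.sum_le_sum fun i _ => ?_
    have e1 := mul_nonneg (mul_nonneg hci.le hL) (hE0 i)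
    have e2 := mul_nonneg (pow_nonneg hci.le 3) (sq_nonneg ‖b i‖)
    nlinarith
  -- Averaging `b_i + δ_i = bhat_i + Δ` isolates `Δ`.
  have hmean : (m : ℝ) * ‖Δ‖ ≤ ∑ i : Fin m, (‖b i‖ + ‖δ i‖) := by
    have hid : (m : ℝ) • Δ = ∑ i : Fin m, (b i + δ i) := by
      have : ∀ i : Fin m, b i + δ i = bhat i + Δ := fun i => by
        simp only [hδ]
        rw [sub_sub_eq_add_sub, add_sub_cancel]
      rw [Finset.sum_congr rfl fun i _ => this i, Finset.sum_add_distrib, hsum0]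
      simp [Nat.cast_smul_eq_nsmul]
    rw [← abs_of_pos hm0, ← Real.norm_eq_abs, ← norm_smul, hid]
    exact (norm_sum_le _ _).trans (Finset.sum_le_sum fun i _ => norm_add_le _ _)
  have hterm : ∀ i : Fin m, ‖b i‖ + ‖δ i‖ ≤ 1 + τ i + (E i + ‖b i‖ ^ 2) + q i := by
    intro i
    have e1 : ‖b i‖ ≤ 1 + ‖b i‖ ^ 2 := by nlinarith [sq_nonneg (‖b i‖ - 1)]
    -- From `‖δ_i‖² ≤ τ_i q_i ≤ (τ_i + q_i)²`.
    have e2 : ‖δ i‖ ≤ τ i + q i := by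
      refine abs_le_of_sq_le_sq' ((hd i (δ i)).trans ?_) (add_nonneg (hτ i) (hq0 i)) |>.2
      change τ i * q i ≤ _
      nlinarith [hτ i, hq0 i, mul_nonneg (hτ i) (hq0 i)]
    have := hE0 i
    linarith
  have hfin : (m : ℝ) * ‖Δ‖ ≤ m + ∑ i : Fin m, τ i +
      (1 + c₀⁻¹ ^ 3 + c₀⁻¹ * L) * ∑ i : Fin m, (E i + ‖b i‖ ^ 2) := by
    refine hmean.trans ((Finset.sum_le_sum fun i _ => hterm i).trans ?_)
    rw [Finset.sum_add_distrib, Finset.sum_add_distrib, Finset.sum_add_distrib]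
    rw [← Finset.mul_sum] at hqtot
    simp only [Finset.sum_const, Finset.card_univ, Fintype.card_fin, nsmul_eq_mul, mul_one]
    linarith
  have hdiv := mul_le_mul_of_nonneg_left hfin (inv_nonneg.2 hm0.le)
  rw [inv_mul_cancel_left₀ hm0.ne'] at hdiv
  refine hdiv.trans (le_of_eq ?_)
  rw [averageEnergy, mul_add, mul_add, inv_mul_cancel₀ hm0.ne']
  ring

/-- The normalized error of the fixed effects is the normalized sum of the random effects, up to
the sum of the scoring steps and a term of second order. -/
lemma IsPQLEstimate.norm_error_le (h : IsPQLEstimate a c φ G m n x y βhat bhat)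
    (ha : ContDiff ℝ 3 a) (hc₀ : 0 < c₀) (h0 : ∀ η, c₀ ≤ iteratedDeriv 2 a η)
    (h1 : ∀ η, iteratedDeriv 2 a η ≤ c₀⁻¹) (h3 : ∀ η, |iteratedDeriv 3 a η| ≤ c₀⁻¹)
    (hφ : 0 < φ) (hG : G.PosDef) (hm : 0 < m) (hτ : ∀ i, 0 ≤ τ i)
    (hd : ∀ i : Fin m, DesignBound (n i) (x i) (τ i)) (hB0 : 0 ≤ B)
    (hB : ∀ i < m, ∀ j < n i, ‖x i j‖ ≤ B) :
    ‖√(m : ℝ) • (βhat - β) - (√(m : ℝ))⁻¹ • ∑ i : Fin m, b i‖ ≤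
      normalizedStep a m n x β b y + c₀⁻¹ * (1 + B * c₀⁻¹ ^ 2) *
        ((c₀⁻¹ ^ 2 + 2 * penaltyBound φ G) * (1 + ‖βhat - β‖ ^ 2)) *
        weightedEnergy a m n x β b y τ := by
  have hci : 0 < c₀⁻¹ := inv_pos.2 hc₀
  have hm0 : (0 : ℝ) < m := by exact_mod_cast hm
  set L := penaltyBound φ G
  have hL : 0 ≤ L := penaltyBound_nonneg hφ
  have hW : (φ • G⁻¹).PosSemidef := posSemidef_penalty hφ hG
  set Δ := βhat - β with hΔ
  set δ : Fin m → Vec p := fun i => bhat i - (b i - Δ) with hδ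
  set E : Fin m → ℝ := fun i => scoreEnergy a (n i) (x i) β (b i) (y i) with hE
  set t : Fin m → Vec p := fun i => scoringStep a (n i) (x i) β (b i) (y i) with ht
  set K := c₀⁻¹ * (1 + B * c₀⁻¹ ^ 2) with hK
  have hK0 : 0 ≤ K := by positivity
  have hE0 : ∀ i, 0 ≤ E i := fun i => scoreEnergy_nonneg fun η => hc₀.le.trans (h0 η)
  have hsq : (√(m : ℝ))⁻¹ * m = √(m : ℝ) := by
    rw [inv_mul_eq_div, Real.div_sqrt]
  have hid : √(m : ℝ) • Δ - (√(m : ℝ))⁻¹ • ∑ i : Fin m, b i = (√(m : ℝ))⁻¹ • ∑ i, δ i := by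
    have hδs : ∑ i, δ i = (m : ℝ) • Δ - ∑ i : Fin m, b i := by
      have : ∀ i : Fin m, δ i = bhat i + Δ - b i := fun i =>
        sub_sub_eq_add_sub _ _ _
      rw [Finset.sum_congr rfl fun i _ => this i, Finset.sum_sub_distrib, Finset.sum_add_distrib,
        h.sum_eq_zero ha hG]
      simp [Nat.cast_smul_eq_nsmul]
    rw [hδs, smul_sub _ ((m : ℝ) • Δ), smul_smul, hsq]
  have hclus : ∀ i, ‖δ i - t i‖ ≤
      K * ((c₀⁻¹ ^ 2 + 2 * L) * (1 + ‖Δ‖ ^ 2)) * (τ i * (1 + (E i + ‖b i‖ ^ 2))) := by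
    intro i
    have hs := norm_sub_scoringStep_le_energy ha hc₀ h0 h1 h3 (hτ i) (hd i) hB0 (hB i i.2) hW hL
      (dotProduct_penalty_le hφ) (h.score_eq_error (b := b) (β := β) ha hφ hG i)
      (u := b i - Δ) rfl
    refine hs.trans ?_
    have hu : ‖b i - Δ‖ ^ 2 ≤ 2 * (‖b i‖ ^ 2 + ‖Δ‖ ^ 2) := by
      have e := _root_.norm_sub_le (b i) Δ
      have := norm_nonneg (b i - Δ)
      nlinarith [sq_nonneg (‖b i‖ - ‖Δ‖)]
    -- Enlarging the bound to a product separates the common factor in `L` and `Δ` from the energy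
    -- of the cluster.
    have hbr : L + c₀⁻¹ ^ 2 * E i + L * ‖b i - Δ‖ ^ 2 ≤
        (c₀⁻¹ ^ 2 + 2 * L) * (1 + ‖Δ‖ ^ 2) * (1 + (E i + ‖b i‖ ^ 2)) := by
      have e1 := mul_le_mul_of_nonneg_left hu hL
      have e2 : 0 ≤ c₀⁻¹ ^ 2 := sq_nonneg _
      have e3 := hE0 i
      have e4 := sq_nonneg ‖Δ‖
      have e5 := sq_nonneg ‖b i‖
      have f1 := mul_nonneg e2 e4
      have f2 := mul_nonneg e2 e5
      have f3 := mul_nonneg f1 (add_nonneg e3 e5)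
      have f4 := mul_nonneg hL e3
      have f5 := mul_nonneg (mul_nonneg hL e4) (add_nonneg e3 e5)
      nlinarith
    calc _ ≤ τ i * K * ((c₀⁻¹ ^ 2 + 2 * L) * (1 + ‖Δ‖ ^ 2) * (1 + (E i + ‖b i‖ ^ 2))) :=
          mul_le_mul_of_nonneg_left hbr (mul_nonneg (hτ i) hK0)
      _ = _ := by ring
  have hsm : 0 ≤ (√(m : ℝ))⁻¹ := inv_nonneg.2 (Real.sqrt_nonneg _)
  have hsplit : ∑ i, δ i = ∑ i, t i + ∑ i, (δ i - t i) := by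
    rw [← Finset.sum_add_distrib]
    exact Finset.sum_congr rfl fun i _ => (add_sub_cancel _ _).symm
  rw [hid, norm_smul, Real.norm_of_nonneg hsm, hsplit]
  calc _ ≤ (√(m : ℝ))⁻¹ * (‖∑ i, t i‖ + ∑ i : Fin m, K * ((c₀⁻¹ ^ 2 + 2 * L) * (1 + ‖Δ‖ ^ 2)) *
        (τ i * (1 + (E i + ‖b i‖ ^ 2)))) := by
        refine mul_le_mul_of_nonneg_left ((norm_add_le _ _).trans (add_le_add le_rfl ?_)) hsm
        exact (norm_sum_le _ _).trans (Finset.sum_le_sum fun i _ => hclus i)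
    _ = _ := by
        rw [← Finset.mul_sum, normalizedStep, weightedEnergy, mul_add]
        congr 1
        exact mul_left_comm _ _ _

end Stage

/-! ### Convergence in probability -/

section Probability

variable {Ω : Type*} [MeasurableSpace Ω] {μ : Measure Ω}

lemma measure_ge_le_of_lintegral_le {f : Ω → ℝ} (hf : AEMeasurable f μ) {C ε : ℝ} (hε : 0 < ε)
    (h : ∫⁻ ω, ENNReal.ofReal (f ω) ∂μ ≤ ENNReal.ofReal C) :
    μ {ω | ε ≤ f ω} ≤ ENNReal.ofReal (C / ε) := by
  have hsub : {ω | ε ≤ f ω} ⊆ {ω | ENNReal.ofReal ε ≤ ENNReal.ofReal (f ω)} := fun ω hω =>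
    ENNReal.ofReal_le_ofReal hω
  have hne : ENNReal.ofReal ε ≠ 0 := by simpa using hε
  refine (measure_mono hsub).trans ((meas_ge_le_lintegral_div hf.ennreal_ofReal hne
    ENNReal.ofReal_ne_top).trans ?_)
  rw [ENNReal.ofReal_div_of_pos hε]
  exact ENNReal.div_le_div_right h _

lemma tendsto_measure_ge_of_lintegral_le {f : ℕ → Ω → ℝ} {r : ℕ → ℝ}
    (h : ∀ᶠ k in atTop, AEMeasurable (f k) μ ∧
      ∫⁻ ω, ENNReal.ofReal (f k ω) ∂μ ≤ ENNReal.ofReal (r k))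
    (hr : Tendsto r atTop (𝓝 0)) {ε : ℝ} (hε : 0 < ε) :
    Tendsto (fun k => μ {ω | ε ≤ f k ω}) atTop (𝓝 0) := by
  have hlim : Tendsto (fun k => ENNReal.ofReal (r k / ε)) atTop (𝓝 0) := by
    have := ENNReal.tendsto_ofReal (hr.div_const ε)
    simpa using this
  refine tendsto_of_tendsto_of_tendsto_of_le_of_le' tendsto_const_nhds hlim
    (Eventually.of_forall fun k => zero_le) ?_
  filter_upwards [h] with k hk using measure_ge_le_of_lintegral_le hk.1 hε hk.2

lemma boundedInProbability_of_lintegral_le {f : ℕ → Ω → ℝ} {C : ℝ}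
    (h : ∀ᶠ k in atTop, AEMeasurable (f k) μ ∧ (∀ ω, 0 ≤ f k ω) ∧
      ∫⁻ ω, ENNReal.ofReal (f k ω) ∂μ ≤ ENNReal.ofReal C) :
    BoundedInProbability μ f := by
  intro ε hε
  have hM : 0 < (|C| + 1) / ε := by positivity
  refine ⟨(|C| + 1) / ε, ?_⟩
  filter_upwards [h] with k hk
  have hsub : {ω | (|C| + 1) / ε < |f k ω|} ⊆ {ω | (|C| + 1) / ε ≤ f k ω} := fun ω hω => by
    have hω' : (|C| + 1) / ε < |f k ω| := hω
    rw [abs_of_nonneg (hk.2.1 ω)] at hω'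
    exact hω'.le
  refine (measure_mono hsub).trans ((measure_ge_le_of_lintegral_le hk.1 hM hk.2.2).trans
    (ENNReal.ofReal_le_ofReal ?_))
  rw [div_div_eq_mul_div, div_le_iff₀ (by positivity)]
  nlinarith [le_abs_self C]

lemma BoundedInProbability.add {f g : ℕ → Ω → ℝ} (hf : BoundedInProbability μ f)
    (hg : BoundedInProbability μ g) : BoundedInProbability μ fun k ω => f k ω + g k ω := by
  intro ε hε
  obtain ⟨M, hM⟩ := hf (ε / 2) (half_pos hε)
  obtain ⟨N, hN⟩ := hg (ε / 2) (half_pos hε)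
  refine ⟨M + N, ?_⟩
  filter_upwards [hM, hN] with k h1 h2
  have hsub : {ω | M + N < |f k ω + g k ω|} ⊆ {ω | M < |f k ω|} ∪ {ω | N < |g k ω|} := by
    intro ω hω
    by_contra hcon
    simp only [Set.mem_union, Set.mem_ofPred_eq, not_or, not_lt] at hcon hω
    have := abs_add_le (f k ω) (g k ω)
    linarith
  refine (measure_mono hsub).trans ((measure_union_le _ _).trans ((add_le_add h1 h2).trans ?_))
  rw [← ENNReal.ofReal_add (by positivity) (by positivity), add_halves]

lemma BoundedInProbability.mul {f g : ℕ → Ω → ℝ} (hf : BoundedInProbability μ f)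
    (hg : BoundedInProbability μ g) : BoundedInProbability μ fun k ω => f k ω * g k ω := by
  intro ε hε
  obtain ⟨M, hM⟩ := hf (ε / 2) (half_pos hε)
  obtain ⟨N, hN⟩ := hg (ε / 2) (half_pos hε)
  refine ⟨|M| * |N|, ?_⟩
  filter_upwards [hM, hN] with k h1 h2
  have hsub : {ω | |M| * |N| < |f k ω * g k ω|} ⊆ {ω | M < |f k ω|} ∪ {ω | N < |g k ω|} := by
    intro ω hω
    by_contra hcon
    simp only [Set.mem_union, Set.mem_ofPred_eq, not_or, not_lt] at hcon hω
    rw [abs_mul] at hω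
    exact absurd hω (not_lt.2 (mul_le_mul (hcon.1.trans (le_abs_self M))
      (hcon.2.trans (le_abs_self N)) (abs_nonneg _) (abs_nonneg _)))
  refine (measure_mono hsub).trans ((measure_union_le _ _).trans ((add_le_add h1 h2).trans ?_))
  rw [← ENNReal.ofReal_add (by positivity) (by positivity), add_halves]

lemma BoundedInProbability.sum {ι : Type*} (s : Finset ι) {f : ι → ℕ → Ω → ℝ}
    (hf : ∀ i, BoundedInProbability μ (f i)) :
    BoundedInProbability μ fun k ω => ∑ i ∈ s, f i k ω := by
  classical
  induction s using Finset.induction_on with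
  | empty => exact fun ε _ => ⟨0, Eventually.of_forall fun k => by simp⟩
  | insert i s his ih =>
    simp_rw [Finset.sum_insert his]
    exact (hf i).add ih

lemma BoundedInProbability.abs {f : ℕ → Ω → ℝ} (hf : BoundedInProbability μ f) :
    BoundedInProbability μ fun k ω => |f k ω| := by
  simpa [BoundedInProbability] using hf

/-- A sequence dominated by `Z + F(L, V) U`, with `Z` and `U` tending to zero in probability and
`L` and `V` bounded in probability, tends to zero in probability. -/
lemma tendstoInMeasure_zero_of_norm_le {E : Type*} [NormedAddCommGroup E] {Y : ℕ → Ω → E}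
    {Z U L V : ℕ → Ω → ℝ} (F : ℝ → ℝ) (hF : ∀ M, 0 ≤ M → 0 ≤ F M)
    (hY : ∀ᶠ k in atTop, ∀ᵐ ω ∂μ, ∀ M, |L k ω| ≤ M → |V k ω| ≤ M → ‖Y k ω‖ ≤ Z k ω + F M * U k ω)
    (hZ : ∀ ε : ℝ, 0 < ε → Tendsto (fun k => μ {ω | ε ≤ Z k ω}) atTop (𝓝 0))
    (hU : ∀ ε : ℝ, 0 < ε → Tendsto (fun k => μ {ω | ε ≤ U k ω}) atTop (𝓝 0))
    (hL : BoundedInProbability μ L) (hV : BoundedInProbability μ V) :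
    TendstoInMeasure μ Y atTop (fun _ => 0) := by
  rw [tendstoInMeasure_iff_norm]
  intro ε hε
  rw [ENNReal.tendsto_nhds_zero]
  intro η hη
  obtain ⟨η', hη'0, hη'⟩ : ∃ η' : ℝ, 0 < η' ∧ ENNReal.ofReal η' ≤ η := by
    by_cases htop : η = ∞
    · exact ⟨1, one_pos, by simp [htop]⟩
    · exact ⟨η.toReal, ENNReal.toReal_pos hη.ne' htop, ENNReal.ofReal_toReal_le⟩
  have h4 : 0 < η' / 4 := by positivity
  obtain ⟨M, hM⟩ := hL (η' / 4) h4
  obtain ⟨N, hN⟩ := hV (η' / 4) h4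
  -- `R` dominates both stochastic bounds, and the maximum with `0` gives `F R ≥ 0`. Below, the
  -- threshold for `U` uses `F R + 1` to avoid dividing by zero.
  set R := max (max M N) 0 with hR
  have hFR : 0 ≤ F R := hF R (le_max_right _ _)
  have hZk := (ENNReal.tendsto_nhds_zero.1 (hZ (ε / 2) (half_pos hε))) (ENNReal.ofReal (η' / 4))
    (by simpa using h4)
  have hUk := (ENNReal.tendsto_nhds_zero.1 (hU (ε / 2 / (F R + 1)) (by positivity)))
    (ENNReal.ofReal (η' / 4)) (by simpa using h4)
  filter_upwards [hY, hM, hN, hZk, hUk] with k hYk hMk hNk hZk hUk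
  have hsub : ({ω | ε ≤ ‖Y k ω - 0‖} : Set Ω) ≤ᵐ[μ]
      ((({ω | M < |L k ω|} ∪ {ω | N < |V k ω|}) ∪ {ω | ε / 2 ≤ Z k ω}) ∪
        {ω | ε / 2 / (F R + 1) ≤ U k ω} : Set Ω) := by
    filter_upwards [hYk] with ω hω hmem
    by_contra hcon
    have hcon' : ¬ ω ∈ ((({ω | M < |L k ω|} ∪ {ω | N < |V k ω|}) ∪ {ω | ε / 2 ≤ Z k ω}) ∪
        {ω | ε / 2 / (F R + 1) ≤ U k ω} : Set Ω) := hcon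
    simp only [Set.mem_union, Set.mem_ofPred_eq, not_or, not_lt, not_le] at hcon'
    obtain ⟨⟨⟨c1, c2⟩, c3⟩, c4⟩ := hcon'
    have hmem' : ε ≤ ‖Y k ω - 0‖ := hmem
    rw [sub_zero] at hmem'
    have hle := hω R (c1.trans ((le_max_left _ _).trans (le_max_left _ _)))
      (c2.trans ((le_max_right _ _).trans (le_max_left _ _)))
    have hpos : 0 < F R + 1 := by linarith
    rw [lt_div_iff₀ hpos] at c4
    have hb : F R * U k ω ≤ ε / 2 := by
      rcases le_total 0 (U k ω) with hu | hu
      · nlinarith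
      · have := mul_nonpos_of_nonneg_of_nonpos hFR hu
        linarith
    linarith
  calc μ {ω | ε ≤ ‖Y k ω - 0‖} ≤ _ := measure_mono_ae hsub
    _ ≤ ((ENNReal.ofReal (η' / 4) + ENNReal.ofReal (η' / 4)) + ENNReal.ofReal (η' / 4)) +
        ENNReal.ofReal (η' / 4) := by
      refine (measure_union_le _ _).trans (add_le_add ?_ hUk)
      refine (measure_union_le _ _).trans (add_le_add ?_ hZk)
      exact (measure_union_le _ _).trans (add_le_add hMk hNk)
    _ = ENNReal.ofReal η' := by
      rw [← ENNReal.ofReal_add h4.le h4.le, ← ENNReal.ofReal_add (by positivity) h4.le,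
        ← ENNReal.ofReal_add (by positivity) h4.le]
      congr 1
      ring
    _ ≤ η := hη'

lemma lintegral_ofReal_sum_le {ι : Type*} [Fintype ι] {f : ι → Ω → ℝ} {ρ : ι → ℝ} {C : ℝ}
    (hC : 0 ≤ C) (hf : ∀ i, AEMeasurable (f i) μ) (hf0 : ∀ i ω, 0 ≤ f i ω) (hρ : ∀ i, 0 ≤ ρ i)
    (h : ∀ i, ∫⁻ ω, ENNReal.ofReal (f i ω) ∂μ ≤ ENNReal.ofReal C) :
    ∫⁻ ω, ENNReal.ofReal (∑ i, ρ i * f i ω) ∂μ ≤ ENNReal.ofReal ((∑ i, ρ i) * C) := by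
  simp_rw [ENNReal.ofReal_sum_of_nonneg fun i (_ : i ∈ Finset.univ) =>
    mul_nonneg (hρ i) (hf0 i _), ENNReal.ofReal_mul (hρ _)]
  rw [lintegral_finsetSum' _ fun i _ => (hf i).ennreal_ofReal.const_mul _, Finset.sum_mul,
    ENNReal.ofReal_sum_of_nonneg fun i _ => mul_nonneg (hρ i) hC]
  refine Finset.sum_le_sum fun i _ => ?_
  rw [lintegral_const_mul'' _ (hf i).ennreal_ofReal, ENNReal.ofReal_mul (hρ i)]
  exact mul_le_mul_right (h i) _

end Probability

/-! ### Consequences of the design condition -/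

section Design

variable {p : ℕ} {Ω : Type*} [MeasurableSpace Ω] {μ : Measure Ω} [IsProbabilityMeasure μ]
  {a : ℝ → ℝ} {φ c₀ : ℝ} {β : Vec p} {m : ℕ → ℕ} {n : ℕ → ℕ → ℕ} {x : ℕ → ℕ → ℕ → Vec p}
  {b : ℕ → ℕ → Ω → Vec p}

lemma minSize_le {m : ℕ} (n : ℕ → ℕ) (i : Fin m) : minSize m n ≤ n i :=
  ciInf_le (OrderBot.bddBelow _) i

lemma minSize_le_meanSize {m : ℕ} (hm : 0 < m) (n : ℕ → ℕ) :
    (minSize m n : ℝ) ≤ meanSize m n := by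
  have hm0 : (0 : ℝ) < m := by exact_mod_cast hm
  rw [meanSize, inv_mul_eq_div, le_div_iff₀ hm0]
  calc (minSize m n : ℝ) * m = ∑ _i : Fin m, (minSize m n : ℝ) := by simp [mul_comm]
    _ ≤ _ := Finset.sum_le_sum fun i _ => by exact_mod_cast minSize_le n i

/-- Nonrandom lower bounds for the designs of the clusters, controlled on average. -/
lemma CondDesign.exists_designBound (h : CondDesign μ a φ β m n x b) (hφ : 0 < φ) (hc₀ : 0 < c₀)
    (h0 : ∀ η, c₀ ≤ iteratedDeriv 2 a η) (h1 : ∀ η, iteratedDeriv 2 a η ≤ c₀⁻¹)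
    (hm : Tendsto m atTop atTop) (hnL : Tendsto (fun k => minSize (m k) (n k)) atTop atTop) :
    ∃ C : ℝ, 0 ≤ C ∧ ∀ᶠ k in atTop, ∃ τ : ℕ → ℝ, (∀ i, 0 ≤ τ i) ∧
      (∀ i : Fin (m k), DesignBound (n k i) (x k i) (τ i)) ∧
      (m k : ℝ)⁻¹ * ∑ i : Fin (m k), τ i ≤ C * (minSize (m k) (n k) : ℝ)⁻¹ := by
  obtain ⟨-, hunit, c₁, hc₁, -, K, hK, hconv⟩ := h
  have h0' : ∀ η, 0 ≤ iteratedDeriv 2 a η := fun η => hc₀.le.trans (h0 η)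
  refine ⟨φ⁻¹ * c₀⁻¹ * (p * c₁⁻¹ + p), by positivity, ?_⟩
  -- Once the probability that some diagonal entry is off by at least `1` falls below one, an
  -- outcome with all entries within `1` of the limit must exist.
  have hsmall : Tendsto (fun k => ∑ r : Fin p, μ {ω | (1 : ℝ≥0∞) ≤ edist
      ((m k : ℝ)⁻¹ * ∑ i : Fin (m k), meanSize (m k) (n k) / (n k i : ℝ) *
          invInfo a φ (n k i) (x k i) β (b k i ω) r r) (K ω r r)}) atTop (𝓝 0) := by
    have := tendsto_finsetSum Finset.univ fun r (_ : r ∈ (Finset.univ : Finset (Fin p))) =>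
      hconv r r 1 one_pos
    simpa using this
  filter_upwards [hunit, hsmall.eventually (gt_mem_nhds zero_lt_one), hm.eventually_gt_atTop 0,
    hnL.eventually_gt_atTop 0] with k hu hs hm0 hn0
  have hu' : ∀ᵐ ω ∂μ, ∀ i : Fin (m k), IsUnit (weightedGram a φ (n k i) (x k i) β (b k i ω)) :=
    ae_all_iff.2 fun i => hu i i.2
  -- A single outcome suffices: the covariates are nonrandom, and `a'' ≤ c₀⁻¹` turns the weighted
  -- form at this `ω` into the unweighted one.
  obtain ⟨ω, hωu, hωK, hωs⟩ : ∃ ω,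
      (∀ i : Fin (m k), IsUnit (weightedGram a φ (n k i) (x k i) β (b k i ω))) ∧
      WellConditioned c₁ (K ω) ∧ ∀ r, edist ((m k : ℝ)⁻¹ * ∑ i : Fin (m k),
        meanSize (m k) (n k) / (n k i : ℝ) * invInfo a φ (n k i) (x k i) β (b k i ω) r r)
        (K ω r r) < 1 := by
    by_contra hcon
    push Not at hcon
    have hcover : (Set.univ : Set Ω) ≤ᵐ[μ] (⋃ r : Fin p, {ω | (1 : ℝ≥0∞) ≤ edist
        ((m k : ℝ)⁻¹ * ∑ i : Fin (m k), meanSize (m k) (n k) / (n k i : ℝ) *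
          invInfo a φ (n k i) (x k i) β (b k i ω) r r) (K ω r r)} : Set Ω) := by
      filter_upwards [hu', hK] with ω hω1 hω2 _
      obtain ⟨r, hr⟩ := hcon ω hω1 hω2
      exact Set.mem_iUnion.2 ⟨r, hr⟩
    have := (measure_mono_ae hcover).trans (measure_iUnion_fintype_le _ _)
    rw [measure_univ] at this
    exact absurd hs (not_lt.2 this)
  set T : Fin (m k) → ℝ := fun i => (weightedGram a φ (n k i) (x k i) β (b k i ω))⁻¹.trace with hT
  refine ⟨fun i => (weightedGram a φ (n k i) (x k i) β (b k i ω))⁻¹.trace * (φ⁻¹ * c₀⁻¹),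
    fun i => mul_nonneg (posSemidef_weightedGram hφ h0').inv.trace_nonneg (by positivity),
    fun i v => norm_sq_le_trace_mul_sum_sq hφ h0' h1 (hωu i) v, ?_⟩
  have hmean := minSize_le_meanSize hm0 (n k)
  have hmin : (0 : ℝ) < minSize (m k) (n k) := by exact_mod_cast hn0
  -- The factor `n / n_i` in the design condition cancels the `n_i` in `H_i`, leaving the mean size
  -- times the plain average of the traces. As the mean size is at least `n_L`, the rate `1 / n_L`
  -- follows.
  have htr : meanSize (m k) (n k) * ((m k : ℝ)⁻¹ * ∑ i, T i) ≤ p * c₁⁻¹ + p := by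
    have hexp : meanSize (m k) (n k) * ((m k : ℝ)⁻¹ * ∑ i, T i) =
        ∑ r : Fin p, (m k : ℝ)⁻¹ * ∑ i : Fin (m k), meanSize (m k) (n k) / (n k i : ℝ) *
          invInfo a φ (n k i) (x k i) β (b k i ω) r r := by
      rw [← Finset.mul_sum, Finset.sum_comm, mul_left_comm, Finset.mul_sum]
      congr 1
      refine Finset.sum_congr rfl fun i _ => ?_
      have hni : 0 < n k i := hn0.trans_le (minSize_le (n k) i)
      have hni' : (n k i : ℝ) ≠ 0 := by exact_mod_cast hni.ne'
      rw [← Finset.mul_sum]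
      change _ = _ * (invInfo a φ (n k i) (x k i) β (b k i ω)).trace
      rw [trace_invInfo hni, ← mul_assoc, div_mul_cancel₀ _ hni']
    rw [hexp]
    calc _ ≤ ∑ r : Fin p, (K ω r r + 1) := by
          refine Finset.sum_le_sum fun r _ => ?_
          have := hωs r
          rw [edist_dist, ← ENNReal.ofReal_one, ENNReal.ofReal_lt_ofReal_iff one_pos,
            Real.dist_eq] at this
          linarith [(abs_lt.1 this).2]
      _ = (K ω).trace + p := by
          rw [Finset.sum_add_distrib]
          simp [Matrix.trace]
      _ ≤ _ := by linarith [trace_le_of_wellConditioned hωK]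
  have hS0 : 0 ≤ (m k : ℝ)⁻¹ * ∑ i, T i :=
    mul_nonneg (by positivity) (Finset.sum_nonneg fun i _ =>
      (posSemidef_weightedGram hφ h0').inv.trace_nonneg)
  have hS : (m k : ℝ)⁻¹ * ∑ i, T i ≤ (p * c₁⁻¹ + p) * (minSize (m k) (n k) : ℝ)⁻¹ := by
    rw [← div_eq_mul_inv, le_div_iff₀ hmin, mul_comm]
    exact (mul_le_mul_of_nonneg_right hmean hS0).trans htr
  rw [← Finset.sum_mul]
  calc (m k : ℝ)⁻¹ * ((∑ i, T i) * (φ⁻¹ * c₀⁻¹)) = φ⁻¹ * c₀⁻¹ * ((m k : ℝ)⁻¹ * ∑ i, T i) := by ring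
    _ ≤ φ⁻¹ * c₀⁻¹ * ((p * c₁⁻¹ + p) * (minSize (m k) (n k) : ℝ)⁻¹) :=
        mul_le_mul_of_nonneg_left hS (by positivity)
    _ = _ := by ring

end Design

/-! ### Moments of the energies -/

section Energy

variable {p : ℕ} {Ω : Type*} [MeasurableSpace Ω] {μ : Measure Ω}
  {ν : Measure ℝ} {a : ℝ → ℝ} {c : ℝ → ℝ → ℝ} {φ c₀ : ℝ} {β : Vec p}
  {G : Matrix (Fin p) (Fin p) ℝ} {m : ℕ} {n : ℕ → ℕ} {x : ℕ → ℕ → Vec p}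
  {b : ℕ → Ω → Vec p} {y : ℕ → ℕ → Ω → ℝ} {τ : ℕ → ℝ}

lemma HasGLMMLaw.aemeasurable_scoringStep (h : HasGLMMLaw μ ν a c φ β G m n x b y)
    (ha : ContDiff ℝ 3 a) (i : Fin m)
    (hpd : ∀ b, (weightedGram a 1 (n i) (x i) β b).PosDef) :
    AEMeasurable (fun ω => scoringStep a (n i) (x i) β (b i ω) (fun j => y i j ω)) μ := by
  have hda : Continuous (deriv a) := ha.continuous_deriv (by norm_num)
  refine Finset.aemeasurable_fun_sum _ fun j _ => ?_
  refine AEMeasurable.smul ((h.2.1 i i.2 j j.2).sub ?_) ?_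
  · exact (hda.comp (continuous_linPred _ _)).measurable.comp_aemeasurable (h.1 i i.2)
  · exact (continuous_influence ha hpd j).measurable.comp_aemeasurable (h.1 i i.2)

lemma HasGLMMLaw.aemeasurable_scoreEnergy (h : HasGLMMLaw μ ν a c φ β G m n x b y)
    (ha : ContDiff ℝ 3 a) (i : Fin m)
    (hpd : ∀ b, (weightedGram a 1 (n i) (x i) β b).PosDef) :
    AEMeasurable (fun ω => scoreEnergy a (n i) (x i) β (b i ω) (fun j => y i j ω)) μ := by
  have hca := ha.continuous_iteratedDeriv 2 (by norm_num)
  have ht := h.aemeasurable_scoringStep ha i hpd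
  refine Finset.aemeasurable_fun_sum _ fun l _ => ?_
  refine AEMeasurable.mul ?_ ?_
  · exact (hca.comp (continuous_linPred _ _)).measurable.comp_aemeasurable (h.1 i i.2)
  · exact (aemeasurable_const.inner ht).pow_const 2

/-- The second moment of a random effect. -/
def effectMoment (G : Matrix (Fin p) (Fin p) ℝ) : ℝ :=
  (∫⁻ v, ENNReal.ofReal (‖v‖ ^ 2) ∂(multivariateGaussian (0 : Vec p) G)).toReal

lemma effectMoment_nonneg : 0 ≤ effectMoment G := ENNReal.toReal_nonneg

variable [SigmaFinite ν]

lemma HasGLMMLaw.lintegral_energy_le (h : HasGLMMLaw μ ν a c φ β G m n x b y)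
    (hfam : IsExpFamily ν a c φ) (hφ : 0 < φ) (ha : ContDiff ℝ 3 a) (hc₀ : 0 < c₀)
    (h0 : ∀ η, c₀ ≤ iteratedDeriv 2 a η) (i : Fin m) (hτ : 0 ≤ τ i)
    (hd : DesignBound (n i) (x i) (τ i)) :
    ∫⁻ ω, ENNReal.ofReal (scoreEnergy a (n i) (x i) β (b i ω) (fun j => y i j ω) + ‖b i ω‖ ^ 2) ∂μ
      ≤ ENNReal.ofReal (φ * p + effectMoment G) := by
  have hE0 : ∀ ω, 0 ≤ scoreEnergy a (n i) (x i) β (b i ω) (fun j => y i j ω) := fun ω =>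
    scoreEnergy_nonneg fun η => hc₀.le.trans (h0 η)
  simp_rw [ENNReal.ofReal_add (hE0 _) (sq_nonneg _)]
  rw [lintegral_add_left' (h.aemeasurable_scoreEnergy ha i fun b =>
    hd.posDef_weightedGram hτ hc₀ h0).ennreal_ofReal,
    ENNReal.ofReal_add (by positivity) effectMoment_nonneg]
  refine add_le_add (h.lintegral_scoreEnergy_le hfam hφ ha hc₀ h0 i hτ hd) (le_of_eq ?_)
  rw [h.lintegral_norm_sq hfam ha.continuous i, effectMoment,
    ENNReal.ofReal_toReal (lintegral_norm_sq_multivariateGaussian_lt_top G).ne]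

lemma HasGLMMLaw.averageEnergy_moment (h : HasGLMMLaw μ ν a c φ β G m n x b y)
    (hfam : IsExpFamily ν a c φ) (hφ : 0 < φ) (ha : ContDiff ℝ 3 a) (hc₀ : 0 < c₀)
    (h0 : ∀ η, c₀ ≤ iteratedDeriv 2 a η) (hm : 0 < m) (hτ : ∀ i, 0 ≤ τ i)
    (hd : ∀ i : Fin m, DesignBound (n i) (x i) (τ i)) :
    AEMeasurable (fun ω => averageEnergy a m n x β (fun i => b i ω) (fun i j => y i j ω)) μ ∧
    (∀ ω, 0 ≤ averageEnergy a m n x β (fun i => b i ω) (fun i j => y i j ω)) ∧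
    ∫⁻ ω, ENNReal.ofReal (averageEnergy a m n x β (fun i => b i ω) (fun i j => y i j ω)) ∂μ ≤
      ENNReal.ofReal (φ * p + effectMoment G) := by
  have hm0 : (0 : ℝ) < m := by exact_mod_cast hm
  have hmeas : ∀ i : Fin m, AEMeasurable (fun ω =>
      scoreEnergy a (n i) (x i) β (b i ω) (fun j => y i j ω) + ‖b i ω‖ ^ 2) μ := fun i =>
    (h.aemeasurable_scoreEnergy ha i fun b => (hd i).posDef_weightedGram (hτ i) hc₀ h0).add
      ((h.1 i i.2).norm.pow_const 2)
  have hnn : ∀ (i : Fin m) ω,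
      0 ≤ scoreEnergy a (n i) (x i) β (b i ω) (fun j => y i j ω) + ‖b i ω‖ ^ 2 := fun i ω =>
    add_nonneg (scoreEnergy_nonneg fun η => hc₀.le.trans (h0 η)) (sq_nonneg _)
  refine ⟨(Finset.aemeasurable_fun_sum _ fun i _ => hmeas i).const_mul _,
    fun ω => mul_nonneg (by positivity) (Finset.sum_nonneg fun i _ => hnn i ω), ?_⟩
  have := lintegral_ofReal_sum_le (ρ := fun _ : Fin m => (m : ℝ)⁻¹)
    (C := φ * p + effectMoment G)
    (add_nonneg (by positivity) effectMoment_nonneg) hmeas hnn (fun i => by positivity)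
    fun i => h.lintegral_energy_le hfam hφ ha hc₀ h0 i (hτ i) (hd i)
  simp_rw [averageEnergy, Finset.mul_sum]
  refine this.trans (ENNReal.ofReal_le_ofReal (le_of_eq ?_))
  simp [mul_inv_cancel₀ hm0.ne']

/-- With the mean of the `τ i` of order `1 / n_L`, this bound is of order `√m / n_L`: the place
where the growth rate enters. -/
lemma HasGLMMLaw.weightedEnergy_moment [IsProbabilityMeasure μ]
    (h : HasGLMMLaw μ ν a c φ β G m n x b y)
    (hfam : IsExpFamily ν a c φ) (hφ : 0 < φ) (ha : ContDiff ℝ 3 a) (hc₀ : 0 < c₀)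
    (h0 : ∀ η, c₀ ≤ iteratedDeriv 2 a η) (hτ : ∀ i, 0 ≤ τ i)
    (hd : ∀ i : Fin m, DesignBound (n i) (x i) (τ i)) :
    AEMeasurable (fun ω => weightedEnergy a m n x β (fun i => b i ω) (fun i j => y i j ω) τ) μ ∧
    ∫⁻ ω, ENNReal.ofReal (weightedEnergy a m n x β (fun i => b i ω) (fun i j => y i j ω) τ) ∂μ ≤
      ENNReal.ofReal (√(m : ℝ) * ((m : ℝ)⁻¹ * ∑ i : Fin m, τ i) *
        (1 + (φ * p + effectMoment G))) := by
  have hmeas : ∀ i : Fin m, AEMeasurable (fun ω =>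
      1 + (scoreEnergy a (n i) (x i) β (b i ω) (fun j => y i j ω) + ‖b i ω‖ ^ 2)) μ := fun i =>
    ((h.aemeasurable_scoreEnergy ha i fun b => (hd i).posDef_weightedGram (hτ i) hc₀ h0).add
      ((h.1 i i.2).norm.pow_const 2)).const_add 1
  have hnn : ∀ (i : Fin m) ω,
      0 ≤ scoreEnergy a (n i) (x i) β (b i ω) (fun j => y i j ω) + ‖b i ω‖ ^ 2 := fun i ω =>
    add_nonneg (scoreEnergy_nonneg fun η => hc₀.le.trans (h0 η)) (sq_nonneg _)
  have hC0 : 0 ≤ φ * p + effectMoment G := add_nonneg (by positivity) effectMoment_nonneg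
  refine ⟨(Finset.aemeasurable_fun_sum _ fun i _ => (hmeas i).const_mul _).const_mul _, ?_⟩
  have := lintegral_ofReal_sum_le (ρ := fun i : Fin m => (√(m : ℝ))⁻¹ * τ i)
    (C := 1 + (φ * p + effectMoment G)) (by positivity) hmeas
    (fun i ω => add_nonneg zero_le_one (hnn i ω)) (fun i => mul_nonneg (by positivity) (hτ i))
    fun i => by
      simp_rw [ENNReal.ofReal_add zero_le_one (hnn i _)]
      rw [lintegral_add_left measurable_const, ENNReal.ofReal_add zero_le_one hC0]
      refine add_le_add (by simp) (h.lintegral_energy_le hfam hφ ha hc₀ h0 i (hτ i) (hd i))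
  simp_rw [weightedEnergy, Finset.mul_sum, ← mul_assoc]
  refine this.trans (ENNReal.ofReal_le_ofReal (le_of_eq ?_))
  simp_rw [← div_eq_mul_inv, Real.sqrt_div_self]

/-- Centering and conditional independence keep this at the order of the mean of the `τ i`, without
the factor `√m`. -/
lemma HasGLMMLaw.normalizedStep_moment (h : HasGLMMLaw μ ν a c φ β G m n x b y)
    (hfam : IsExpFamily ν a c φ) (hφ : 0 < φ) (ha : ContDiff ℝ 3 a) (hc₀ : 0 < c₀)
    (h0 : ∀ η, c₀ ≤ iteratedDeriv 2 a η) (hτ : ∀ i, 0 ≤ τ i)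
    (hd : ∀ i : Fin m, DesignBound (n i) (x i) (τ i)) :
    AEMeasurable (fun ω =>
      normalizedStep a m n x β (fun i => b i ω) (fun i j => y i j ω) ^ 2) μ ∧
    ∫⁻ ω, ENNReal.ofReal
      (normalizedStep a m n x β (fun i => b i ω) (fun i j => y i j ω) ^ 2) ∂μ ≤
      ENNReal.ofReal (φ * c₀⁻¹ * p * ((m : ℝ)⁻¹ * ∑ i : Fin m, τ i)) := by
  have hmeas : AEMeasurable (fun ω =>
      ∑ i : Fin m, scoringStep a (n i) (x i) β (b i ω) (fun j => y i j ω)) μ :=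
    Finset.aemeasurable_fun_sum _ fun i _ => h.aemeasurable_scoringStep ha i fun b =>
      (hd i).posDef_weightedGram (hτ i) hc₀ h0
  refine ⟨(hmeas.norm.const_mul _).pow_const 2, ?_⟩
  have hle := h.lintegral_norm_sq_sum_scoringStep_le hfam hφ ha hc₀ h0 hτ hd
  have hm0 : 0 ≤ (m : ℝ)⁻¹ := by positivity
  have hsq : (√(m : ℝ))⁻¹ ^ 2 = (m : ℝ)⁻¹ := by rw [inv_pow, Real.sq_sqrt (Nat.cast_nonneg m)]
  simp_rw [normalizedStep, mul_pow, hsq, ENNReal.ofReal_mul hm0]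
  rw [lintegral_const_mul'' _ (hmeas.norm.pow_const 2).ennreal_ofReal]
  refine (mul_le_mul_right hle _).trans (le_of_eq ?_)
  rw [← ENNReal.ofReal_mul hm0]
  congr 1
  ring

end Energy

/-! ### Asymptotic normality -/

section Asymptotics

variable {p : ℕ} {Ω : Type*} [MeasurableSpace Ω] {μ : Measure Ω}

lemma CondWorking.boundedInProbability_penaltyBound {φhat : ℕ → Ω → ℝ}
    {Ghat : ℕ → Ω → Matrix (Fin p) (Fin p) ℝ} (h : CondWorking μ φhat Ghat) :
    BoundedInProbability μ fun k ω => penaltyBound (φhat k ω) (Ghat k ω) :=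
  h.2.2.2.2.2.mul (BoundedInProbability.sum _ fun r =>
    BoundedInProbability.sum _ fun s => (h.2.2.2.1 r s).abs)

lemma tendsto_sqrt_div_minSize {m : ℕ → ℕ} {n : ℕ → ℕ → ℕ}
    (hrate : Tendsto (fun k => (m k : ℝ) / (minSize (m k) (n k) : ℝ) ^ 2) atTop (𝓝 0)) :
    Tendsto (fun k => √(m k : ℝ) * (minSize (m k) (n k) : ℝ)⁻¹) atTop (𝓝 0) := by
  have := (Real.continuous_sqrt.tendsto 0).comp hrate
  rw [Real.sqrt_zero] at this
  refine this.congr fun k => ?_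
  simp only [Function.comp]
  rw [Real.sqrt_div (Nat.cast_nonneg _), Real.sqrt_sq (Nat.cast_nonneg _), div_eq_mul_inv]

variable [IsProbabilityMeasure μ]

lemma tendstoInMeasure_error {ν : Measure ℝ} [SigmaFinite ν] {a : ℝ → ℝ} {c : ℝ → ℝ → ℝ} {φ : ℝ}
    (hφ : 0 < φ) (hfam : IsExpFamily ν a c φ) {β : Vec p} {G : Matrix (Fin p) (Fin p) ℝ}
    {m : ℕ → ℕ} {n : ℕ → ℕ → ℕ} {x : ℕ → ℕ → ℕ → Vec p}
    {b : ℕ → ℕ → Ω → Vec p} {y : ℕ → ℕ → ℕ → Ω → ℝ}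
    (hmodel : ∀ k, HasGLMMLaw μ ν a c φ β G (m k) (n k) (x k) (b k) (y k))
    {φhat : ℕ → Ω → ℝ} {Ghat : ℕ → Ω → Matrix (Fin p) (Fin p) ℝ}
    {βhat : ℕ → Ω → Vec p} {bhat : (k : ℕ) → Ω → Fin (m k) → Vec p}
    (hhat : ∀ k, ∀ᵐ ω ∂μ, IsPQLEstimate a c (φhat k ω) (Ghat k ω) (m k) (n k) (x k)
      (fun i j => y k i j ω) (βhat k ω) (bhat k ω))
    (hm : Tendsto m atTop atTop)
    (hnL : Tendsto (fun k => minSize (m k) (n k)) atTop atTop)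
    (hrate : Tendsto (fun k => (m k : ℝ) / (minSize (m k) (n k) : ℝ) ^ 2) atTop (𝓝 0))
    (hcumulant : CondCumulant a) (hdesign : CondDesign μ a φ β m n x b)
    (hworking : CondWorking μ φhat Ghat) :
    TendstoInMeasure μ
      (fun k ω => √(m k : ℝ) • (βhat k ω - β) - (√(m k : ℝ))⁻¹ • ∑ i : Fin (m k), b k i ω)
      atTop (fun _ => 0) := by
  obtain ⟨ha, c₀, hc₀, hbd⟩ := hcumulant
  have h0 : ∀ η, c₀ ≤ iteratedDeriv 2 a η := fun η => (hbd η).1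
  have h1 : ∀ η, iteratedDeriv 2 a η ≤ c₀⁻¹ := fun η => (hbd η).2.1
  have h3 : ∀ η, |iteratedDeriv 3 a η| ≤ c₀⁻¹ := fun η => (hbd η).2.2
  obtain ⟨C, hC, hτ'⟩ := hdesign.exists_designBound hφ hc₀ h0 h1 hm hnL
  obtain ⟨τ, hτ⟩ := hτ'.choice
  obtain ⟨B, hB0, hB⟩ : ∃ B : ℝ, 0 ≤ B ∧ ∀ k, ∀ i < m k, ∀ j < n k i, ‖x k i j‖ ≤ B := by
    obtain ⟨C₁, hC₁⟩ := hdesign.1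
    refine ⟨√(∑ _r : Fin p, C₁ ^ 2), Real.sqrt_nonneg _, fun k i hi j hj => ?_⟩
    rw [EuclideanSpace.norm_eq]
    refine Real.sqrt_le_sqrt (Finset.sum_le_sum fun r _ => ?_)
    rw [Real.norm_eq_abs]
    exact pow_le_pow_left₀ (abs_nonneg _) (hC₁ k i hi j hj r).le 2
  have hinv : Tendsto (fun k => (minSize (m k) (n k) : ℝ)⁻¹) atTop (𝓝 0) :=
    tendsto_inv_atTop_zero.comp (tendsto_natCast_atTop_atTop.comp hnL)
  have hmom0 : 0 ≤ φ * p + effectMoment G := add_nonneg (by positivity) effectMoment_nonneg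
  refine tendstoInMeasure_zero_of_norm_le
    (Z := fun k ω => normalizedStep a (m k) (n k) (x k) β (fun i => b k i ω)
      (fun i j => y k i j ω))
    (U := fun k ω => weightedEnergy a (m k) (n k) (x k) β (fun i => b k i ω)
      (fun i j => y k i j ω) (τ k))
    (L := fun k ω => penaltyBound (φhat k ω) (Ghat k ω))
    (V := fun k ω => averageEnergy a (m k) (n k) (x k) β (fun i => b k i ω)
      (fun i j => y k i j ω))
    -- `M` bounds both the penalty and the average energy; the inner bracket is the resulting a
    -- priori bound on `‖βhat - β‖`.
    (fun M => c₀⁻¹ * (1 + B * c₀⁻¹ ^ 2) * ((c₀⁻¹ ^ 2 + 2 * M) *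
      (1 + (1 + C + (1 + c₀⁻¹ ^ 3 + c₀⁻¹ * M) * M) ^ 2)))
    (fun M hM => by positivity) ?_ ?_ ?_ hworking.boundedInProbability_penaltyBound ?_
  · filter_upwards [hτ, hm.eventually_gt_atTop 0, hnL.eventually_gt_atTop 0]
      with k ⟨hτ0, hd, hτC⟩ hm0 hn0
    filter_upwards [hhat k, hworking.2.2.1 k, hworking.2.2.2.2.1 k] with ω hest hG hφh M hLM hVM
    have hbound := hest.norm_error_le (β := β) (b := fun i => b k i ω) ha hc₀ h0 h1 h3 hφh hG hm0
      hτ0 hd hB0 (hB k)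
    have hprior := hest.norm_sub_le (β := β) (b := fun i => b k i ω) ha hc₀ h0 h1 hφh hG hm0
      hτ0 hd
    refine hbound.trans (add_le_add le_rfl ?_)
    have hL0 := penaltyBound_nonneg (G := Ghat k ω) hφh
    have hM0 : 0 ≤ M := (abs_nonneg _).trans hLM
    have hLM' := (le_abs_self _).trans hLM
    have hVM' := (le_abs_self _).trans hVM
    have hE0 : ∀ i : Fin (m k), 0 ≤ scoreEnergy a (n k i) (x k i) β (b k i ω)
        (fun j => y k i j ω) := fun i => scoreEnergy_nonneg fun η => hc₀.le.trans (h0 η)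
    have hU0 : 0 ≤ weightedEnergy a (m k) (n k) (x k) β (fun i => b k i ω)
        (fun i j => y k i j ω) (τ k) :=
      mul_nonneg (by positivity) (Finset.sum_nonneg fun i _ => mul_nonneg (hτ0 i)
        (add_nonneg zero_le_one (add_nonneg (hE0 i) (sq_nonneg _))))
    -- Uses `n_L ≥ 1`, valid for large `k`.
    have hτC' : (m k : ℝ)⁻¹ * ∑ i : Fin (m k), τ k i ≤ C := by
      refine hτC.trans (mul_le_of_le_one_right hC (inv_le_one_of_one_le₀ ?_))
      exact_mod_cast hn0
    have hΔ : ‖βhat k ω - β‖ ≤ 1 + C + (1 + c₀⁻¹ ^ 3 + c₀⁻¹ * M) * M := by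
      refine hprior.trans (add_le_add (by linarith) ?_)
      have hV0 : 0 ≤ averageEnergy a (m k) (n k) (x k) β (fun i => b k i ω)
          (fun i j => y k i j ω) :=
        mul_nonneg (by positivity) (Finset.sum_nonneg fun i _ => add_nonneg (hE0 i) (sq_nonneg _))
      refine mul_le_mul ?_ hVM' hV0 (by positivity)
      gcongr
    refine mul_le_mul_of_nonneg_right ?_ hU0
    gcongr
  · intro ε hε
    have hsq := tendsto_measure_ge_of_lintegral_le (μ := μ)
      (f := fun k ω => normalizedStep a (m k) (n k) (x k) β (fun i => b k i ω)
        (fun i j => y k i j ω) ^ 2)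
      (r := fun k => φ * c₀⁻¹ * p * (C * (minSize (m k) (n k) : ℝ)⁻¹)) ?_ ?_ (pow_pos hε 2)
    · refine tendsto_of_tendsto_of_tendsto_of_le_of_le tendsto_const_nhds hsq
        (fun k => zero_le) fun k => measure_mono fun ω hω => ?_
      exact pow_le_pow_left₀ hε.le hω 2
    · filter_upwards [hτ] with k ⟨hτ0, hd, hτC⟩
      have := (hmodel k).normalizedStep_moment hfam hφ ha hc₀ h0 hτ0 hd
      refine ⟨this.1, this.2.trans (ENNReal.ofReal_le_ofReal ?_)⟩
      exact mul_le_mul_of_nonneg_left hτC (by positivity)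
    · simpa using (hinv.const_mul C).const_mul (φ * c₀⁻¹ * p)
  · intro ε hε
    refine tendsto_measure_ge_of_lintegral_le
      (r := fun k => C * (√(m k : ℝ) * (minSize (m k) (n k) : ℝ)⁻¹) *
        (1 + (φ * p + effectMoment G))) ?_ ?_ hε
    · filter_upwards [hτ] with k ⟨hτ0, hd, hτC⟩
      have := (hmodel k).weightedEnergy_moment hfam hφ ha hc₀ h0 hτ0 hd
      refine ⟨this.1, this.2.trans (ENNReal.ofReal_le_ofReal ?_)⟩
      refine mul_le_mul_of_nonneg_right ?_ (by positivity)
      calc _ ≤ √(m k : ℝ) * (C * (minSize (m k) (n k) : ℝ)⁻¹) :=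
            mul_le_mul_of_nonneg_left hτC (Real.sqrt_nonneg _)
        _ = _ := by ring
    · simpa using ((tendsto_sqrt_div_minSize hrate).const_mul C).mul_const
        (1 + (φ * p + effectMoment G))
  · refine boundedInProbability_of_lintegral_le (C := φ * p + effectMoment G) ?_
    filter_upwards [hτ, hm.eventually_gt_atTop 0] with k ⟨hτ0, hd, hτC⟩ hm0
    exact (hmodel k).averageEnergy_moment hfam hφ ha hc₀ h0 hm0 hτ0 hd

lemma tendstoInDistribution_normalized_sum {ν : Measure ℝ} [SigmaFinite ν] {a : ℝ → ℝ}
    {c : ℝ → ℝ → ℝ} {φ : ℝ} (hfam : IsExpFamily ν a c φ) (ha : Continuous a) {β : Vec p}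
    {G : Matrix (Fin p) (Fin p) ℝ} (hG : G.PosSemidef)
    {m : ℕ → ℕ} {n : ℕ → ℕ → ℕ} {x : ℕ → ℕ → ℕ → Vec p}
    {b : ℕ → ℕ → Ω → Vec p} {y : ℕ → ℕ → ℕ → Ω → ℝ}
    (hmodel : ∀ k, HasGLMMLaw μ ν a c φ β G (m k) (n k) (x k) (b k) (y k))
    (hm : Tendsto m atTop atTop) :
    TendstoInDistribution (fun k ω => (√(m k : ℝ))⁻¹ • ∑ i : Fin (m k), b k i ω) atTop
      (id : Vec p → Vec p) (fun _ => μ) (multivariateGaussian 0 G) where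
  forall_aemeasurable k :=
    (Finset.aemeasurable_fun_sum _ fun (i : Fin (m k)) _ => (hmodel k).1 i i.2).fun_const_smul _
  tendsto := by
    -- The laws equal the limit as soon as `m k > 0`; for `m k = 0` the sum is empty.
    refine tendsto_const_nhds.congr' ?_
    filter_upwards [hm.eventually_gt_atTop 0] with k hk
    refine Subtype.ext ?_
    simp only
    rw [Measure.map_id, (hmodel k).map_normalized_sum hfam ha hG hk]

end Asymptotics

end PQL

end

/-! ### The limit theorem -/

theorem theorem2 {p : ℕ} {Ω : Type*} [MeasurableSpace Ω] (μ : Measure Ω) [IsProbabilityMeasure μ]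
    -- the exponential family and the true parameters
    (ν : Measure ℝ) [SigmaFinite ν] (a : ℝ → ℝ) (c : ℝ → ℝ → ℝ) (φ : ℝ) (hφ : 0 < φ)
    (hfam : PQL.IsExpFamily ν a c φ)
    (β : PQL.Vec p) (G : Matrix (Fin p) (Fin p) ℝ) (hG : G.PosSemidef)
    -- stage `k` has `m k` clusters of sizes `n k i`, `i < m k`
    (m : ℕ → ℕ) (n : ℕ → ℕ → ℕ) (x : ℕ → ℕ → ℕ → PQL.Vec p)
    (b : ℕ → ℕ → Ω → PQL.Vec p) (y : ℕ → ℕ → ℕ → Ω → ℝ)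
    (hmodel : ∀ k, PQL.HasGLMMLaw μ ν a c φ β G (m k) (n k) (x k) (b k) (y k))
    -- working quantities and the PQL estimator
    (φhat : ℕ → Ω → ℝ) (Ghat : ℕ → Ω → Matrix (Fin p) (Fin p) ℝ)
    (βhat : ℕ → Ω → PQL.Vec p) (bhat : (k : ℕ) → Ω → Fin (m k) → PQL.Vec p)
    (hβhat : ∀ k, AEMeasurable (βhat k) μ)
    (hhat : ∀ k, ∀ᵐ ω ∂μ, PQL.IsPQLEstimate a c (φhat k ω) (Ghat k ω) (m k) (n k) (x k)
      (fun i j => y k i j ω) (βhat k ω) (bhat k ω))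
    -- growth of the number of clusters and of the cluster sizes
    (hm : Tendsto m atTop atTop)
    (hnL : Tendsto (fun k => PQL.minSize (m k) (n k)) atTop atTop)
    (hnU : ∃ C : ℝ, ∀ᶠ k in atTop, ∀ i < m k, (n k i : ℝ) ≤ C * PQL.minSize (m k) (n k))
    (hrate : Tendsto (fun k => (m k : ℝ) / (PQL.minSize (m k) (n k) : ℝ) ^ 2) atTop (𝓝 0))
    -- regularity conditions
    (hcumulant : PQL.CondCumulant a)
    (hdesign : PQL.CondDesign μ a φ β m n x b)
    (hworking : PQL.CondWorking μ φhat Ghat)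
    (hmoment : PQL.CondMoment μ a β m n x b y φhat Ghat) :
    TendstoInDistribution (fun k ω => √(m k : ℝ) • (βhat k ω - β)) atTop
      (id : PQL.Vec p → PQL.Vec p) (fun _ => μ) (multivariateGaussian 0 G) ∧
    TendstoInMeasure μ
      (fun k ω => √(m k : ℝ) • (βhat k ω - β) - (√(m k : ℝ))⁻¹ • ∑ i : Fin (m k), b k i ω)
      atTop (fun _ => 0) := by
  have herror := PQL.tendstoInMeasure_error hφ hfam hmodel hhat hm hnL hrate hcumulant hdesign
    hworking
  refine ⟨?_, herror⟩
  -- Slutsky: the normalized error differs from the exactly Gaussian average by a term vanishing in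
  -- probability.
  exact tendstoInDistribution_of_tendstoInMeasure_sub _ _
    (PQL.tendstoInDistribution_normalized_sum hfam hcumulant.1.continuous hG hmodel hm)
    herror fun k => ((hβhat k).sub_const β).fun_const_smul _
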